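/- Let $M$, $B$, $F$ be smooth manifolds (finite-dimensional, Hausdorff, second countable, without boundary, each of constant dimension), let $G$ be a compact Lie group and $G'\le G$ a subgroup that is itself a compact Lie group, and let $G$ and $G'$ act smoothly, freely and properly on $M$ (the action of $G'$ being the restriction of that of $G$). Let $\pi:M\to B$ be a smooth fiber bundle with fiber $F$ such that $\pi$ is constant on $G'$-orbits, and let $N'$ be an embedded submanifold of $B$. Then $N=\pi^{-1}(N')$ is a $G'$-stable embedded submanifold of $M$ with \[ \dim N=\dim N'+\dim F . \] Moreover $M/G$ and $N/G'$ are smooth manifolds (with the unique smooth structures for which the quotient maps $M\to M/G$ and $N\to N/G'$ are smooth submersions), and if \[ \dim(N/G')<\dim(M/G), \] then $N/G$, the set of those $G$-orbits in $M$ that meet $N$ (the image of $N$ under $M\to M/G$), has Lebesgue measure zero in every chart of $M/G$. In particular, if $M/G$ is a Lie group (with this smooth structure), then $N/G$ has Haar measure zero in $M/G$. -/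

import Mathlib

open scoped Manifold ContDiff

/-- A smooth fiber bundle `π : M → B` with fiber `F`, where `M`, `B`, `F` are smooth manifolds of
dimensions `m`, `b`, `f`: every point of `B` has an open neighbourhood `U` with a diffeomorphism
`π⁻¹(U) ≅ U × F` that commutes with the projections to `U`. -/
def IsSmoothFiberBundle (m b f : ℕ) {M B : Type*} (F : Type*)
    [TopologicalSpace M] [ChartedSpace (EuclideanSpace ℝ (Fin m)) M]
    [TopologicalSpace B] [ChartedSpace (EuclideanSpace ℝ (Fin b)) B]
    [TopologicalSpace F] [ChartedSpace (EuclideanSpace ℝ (Fin f)) F]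
    (π : M → B) : Prop :=
  ∀ x : B, ∃ e : Bundle.Trivialization F π, x ∈ e.baseSet ∧
    ContMDiffOn (𝓡 m) ((𝓡 b).prod (𝓡 f)) ∞ e e.source ∧
    ContMDiffOn ((𝓡 b).prod (𝓡 f)) (𝓡 m) ∞ e.toOpenPartialHomeomorph.symm e.target

/-- The charted space structure on the subset `S` (with the subspace topology) of the
`m`-dimensional manifold `M` makes `S` a `k`-dimensional embedded smooth submanifold of `M`. -/
structure IsSubmanifoldStructure (m k : ℕ) {M : Type*}
    [TopologicalSpace M] [ChartedSpace (EuclideanSpace ℝ (Fin m)) M]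
    (S : Set M) [ChartedSpace (EuclideanSpace ℝ (Fin k)) S] : Prop where
  isManifold : IsManifold (𝓡 k) ∞ S
  isSmoothEmbedding : Manifold.IsSmoothEmbedding (𝓡 k) (𝓡 m) ∞ (Subtype.val : S → M)

/-- `S` is a `k`-dimensional embedded smooth submanifold of the `m`-dimensional manifold `M`. -/
def IsSubmanifold (m k : ℕ) {M : Type*}
    [TopologicalSpace M] [ChartedSpace (EuclideanSpace ℝ (Fin m)) M] (S : Set M) : Prop :=
  ∃ _ : ChartedSpace (EuclideanSpace ℝ (Fin k)) S, IsSubmanifoldStructure m k S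

/-- The charted space structure on the topological quotient of the `n`-dimensional manifold `X` by
the equivalence relation `s` makes it the `d`-dimensional quotient manifold: it is a smooth manifold
(Hausdorff and second countable) and the quotient map is a smooth submersion. At most one smooth
structure on the quotient has this property. -/
structure IsQuotientManifold (n d : ℕ) {X : Type*}
    [TopologicalSpace X] [ChartedSpace (EuclideanSpace ℝ (Fin n)) X]
    (s : Setoid X) [ChartedSpace (EuclideanSpace ℝ (Fin d)) (Quotient s)] : Prop where
  t2Space : T2Space (Quotient s)
  secondCountableTopology : SecondCountableTopology (Quotient s)
  isManifold : IsManifold (𝓡 d) ∞ (Quotient s)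
  isSubmersion : Manifold.IsSubmersion (𝓡 n) (𝓡 d) ∞ (Quotient.mk s)

/-- The relation "lying in the same `H`-orbit" on a subset `S` of a space `M` with an action of `H`.
When `S` is `H`-stable, its classes are the `H`-orbits in `S`, and its quotient is `S/H`. -/
def orbitSetoid (H : Type*) {M : Type*} [Group H] [MulAction H M] (S : Set M) : Setoid S :=
  (MulAction.orbitRel H M).comap Subtype.val

/-- The set of `G`-orbits that meet `S`, as a subset of the orbit space `M/G`. -/
def orbitImage (G : Type*) {M : Type*} [Group G] [MulAction G M] (S : Set M) :
    Set (Quotient (MulAction.orbitRel G M)) :=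
  Quotient.mk (MulAction.orbitRel G M) '' S

/-! In a bundle chart, `π` is a product projection, so a chart of `N'` together with a chart of `F`
gives a chart of `N`, of dimension `n' + f`. Stability holds because `π` is constant on `G'`-orbits.

The quotients rest on slices (`exists_slice`). The orbit map of a free action is an immersion
(`injective_mfderiv_orbitMap`): a vector killed at `1` generates a left-invariant field whose
integral curve moves `p` with velocity zero, so by freeness the curve is constant and the vector is
zero. Hence the group times a disc transverse to the orbit maps locally diffeomorphically to the
manifold. Compactness allows the disc to be shrunk until it meets each orbit at most once, and such
discs are the charts of the quotient. Properness makes the quotient Hausdorff. The same argument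
applies to `G'` acting on `N`.

For the null set, `N → M → M/G` is smooth and constant on `G'`-orbits, so its image is already
attained on local sections of `N → N/G'`. Countably many of these suffice, which covers `N/G` by
countably many smooth images of open sets of a space of dimension `k < d`. Each has Hausdorff
dimension at most `k`, hence is null in charts. For Haar measure, a Fubini argument compares `μ`
with Lebesgue measure carried over from one chart. -/

open Set Filter Topology

/-! ### Inverse function theorem and normal forms of submersions and immersions -/

/-- The inverse function theorem: a smooth map on an open set restricts to a diffeomorphism near
every point where its derivative is invertible. -/
theorem ContDiffOn.exists_openPartialHomeomorph {E F : Type*}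
    [NormedAddCommGroup E] [NormedSpace ℝ E] [CompleteSpace E]
    [NormedAddCommGroup F] [NormedSpace ℝ F] {f : E → F} {s : Set E} {a : E} {f' : E ≃L[ℝ] F}
    (hs : IsOpen s) (hf : ContDiffOn ℝ ∞ f s) (ha : a ∈ s) (hf' : HasFDerivAt f (f' : E →L[ℝ] F) a) :
    ∃ e : OpenPartialHomeomorph E F, a ∈ e.source ∧ e.source ⊆ s ∧ (∀ x, e x = f x) ∧
      ContDiffOn ℝ ∞ e.symm e.target := by
  have hfa : ContDiffAt ℝ ∞ f a := hf.contDiffAt (hs.mem_nhds ha)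
  let e₀ := hfa.toOpenPartialHomeomorph f hf' (by simp)
  have hcont : ContinuousOn (fderiv ℝ f) s := hf.continuousOn_fderiv_of_isOpen hs (by simp)
  -- Invertibility is an open condition on the derivative. Shrinking to where it holds makes the
  -- inverse smooth on the whole target, not only at `f a`.
  have hinv : ∀ᶠ x in 𝓝 a, fderiv ℝ f x ∈ range ((↑) : (E ≃L[ℝ] F) → E →L[ℝ] F) := by
    apply (hcont.continuousAt (hs.mem_nhds ha)).eventually
    rw [hf'.fderiv]
    exact ContinuousLinearEquiv.nhds f'
  obtain ⟨t, hts, hto, hat⟩ := mem_nhds_iff.1 (hinv.and (hs.mem_nhds ha))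
  refine ⟨e₀.restrOpen t hto, ⟨hfa.mem_toOpenPartialHomeomorph_source hf' _, hat⟩, ?_, ?_, ?_⟩
  · exact fun x hx ↦ (hts hx.2).2
  · exact fun x ↦ rfl
  · intro y hy
    have hy' := (e₀.restrOpen t hto).map_target hy
    obtain ⟨⟨g', hg'⟩, hys⟩ := hts hy'.2
    have hd : ContDiffAt ℝ ∞ f ((e₀.restrOpen t hto).symm y) := hf.contDiffAt (hs.mem_nhds hys)
    refine ((e₀.restrOpen t hto).contDiffAt_symm (f₀' := g') hy ?_ hd).contDiffWithinAt
    rw [hg']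
    exact (hd.differentiableAt (by simp)).hasFDerivAt

/-- Pair `T` with the projection onto its kernel along a complement. Surjectivity makes the
truncated subtraction in `hm` a true difference. -/
theorem ContinuousLinearMap.exists_equiv_prod_of_surjective {E F : Type*} {m : ℕ}
    [NormedAddCommGroup E] [NormedSpace ℝ E] [FiniteDimensional ℝ E]
    [NormedAddCommGroup F] [NormedSpace ℝ F] [FiniteDimensional ℝ F]
    (T : E →L[ℝ] F) (hT : Function.Surjective T)
    (hm : m = Module.finrank ℝ E - Module.finrank ℝ F) :
    ∃ A : E ≃L[ℝ] F × EuclideanSpace ℝ (Fin m), ∀ u, (A u).1 = T u := by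
  obtain ⟨P, hP⟩ := T.ker.exists_isCompl
  have hfin := T.toLinearMap.finrank_range_add_finrank_ker
  have hrange : T.range = ⊤ := LinearMap.range_eq_top.2 hT
  have hk : Module.finrank ℝ T.ker = m := by
    have h2 : Module.finrank ℝ T.range = Module.finrank ℝ F := by rw [hrange, finrank_top]
    change Module.finrank ℝ T.range + Module.finrank ℝ T.ker = _ at hfin
    omega
  let g : E →ₗ[ℝ] T.ker := T.ker.projectionOnto P hP
  let A₀ := T.toLinearMap.equivProdOfSurjectiveOfIsCompl g hrange
    (Submodule.range_projectionOnto hP) (by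
      rw [Submodule.ker_projectionOnto hP]; exact hP)
  have hfr : Module.finrank ℝ T.ker = Module.finrank ℝ (EuclideanSpace ℝ (Fin m)) := by
    rw [finrank_euclideanSpace_fin, hk]
  let B := LinearEquiv.ofFinrankEq T.ker (EuclideanSpace ℝ (Fin m)) hfr
  exact ⟨(A₀.trans ((LinearEquiv.refl ℝ F).prodCongr B)).toContinuousLinearEquiv, fun u ↦ rfl⟩

/-- A complement of the range supplies the second factor. Injectivity makes the truncated
subtraction in `hm` a true difference. -/
theorem ContinuousLinearMap.exists_equiv_prod_of_injective {E F : Type*} {m : ℕ}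
    [NormedAddCommGroup E] [NormedSpace ℝ E] [FiniteDimensional ℝ E]
    [NormedAddCommGroup F] [NormedSpace ℝ F] [FiniteDimensional ℝ F]
    (T : E →L[ℝ] F) (hT : Function.Injective T)
    (hm : m = Module.finrank ℝ F - Module.finrank ℝ E) :
    ∃ A : (E × EuclideanSpace ℝ (Fin m)) ≃L[ℝ] F, ∀ u, A (u, 0) = T u := by
  obtain ⟨P, hP⟩ := T.range.exists_isCompl
  have hsum := Submodule.finrank_add_eq_of_isCompl hP
  have hr : Module.finrank ℝ T.range = Module.finrank ℝ E := LinearMap.finrank_range_of_inj hT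
  have hfr : Module.finrank ℝ (EuclideanSpace ℝ (Fin m)) = Module.finrank ℝ P := by
    rw [finrank_euclideanSpace_fin]; omega
  let B := LinearEquiv.ofFinrankEq (EuclideanSpace ℝ (Fin m)) P hfr
  let C := LinearEquiv.ofInjective T.toLinearMap hT
  refine ⟨((C.prodCongr B).trans (Submodule.prodEquivOfIsCompl _ _ hP)).toContinuousLinearEquiv,
    fun u ↦ ?_⟩
  change ((Submodule.prodEquivOfIsCompl _ _ hP) (C u, B 0) : F) = T u
  simp [C]

theorem ContMDiffOn.contDiffOn_writtenInCharts {n d : ℕ} {X Y : Type*}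
    [TopologicalSpace X] [ChartedSpace (EuclideanSpace ℝ (Fin n)) X]
    [TopologicalSpace Y] [ChartedSpace (EuclideanSpace ℝ (Fin d)) Y] {f : X → Y} {U : Set X} (hU : IsOpen U)
    (hf : ContMDiffOn (𝓡 n) (𝓡 d) ∞ f U)
    {φ : OpenPartialHomeomorph X (EuclideanSpace ℝ (Fin n))}
    (hφ : φ ∈ IsManifold.maximalAtlas (𝓡 n) ∞ X)
    {ψ : OpenPartialHomeomorph Y (EuclideanSpace ℝ (Fin d))}
    (hψ : ψ ∈ IsManifold.maximalAtlas (𝓡 d) ∞ Y) :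
    IsOpen (φ.target ∩ φ.symm ⁻¹' (U ∩ f ⁻¹' ψ.source)) ∧
    ContDiffOn ℝ ∞ (ψ ∘ f ∘ φ.symm) (φ.target ∩ φ.symm ⁻¹' (U ∩ f ⁻¹' ψ.source)) := by
  refine ⟨φ.isOpen_inter_preimage_symm (hf.continuousOn.isOpen_inter_preimage hU ψ.open_source), ?_⟩
  rw [← contMDiffOn_iff_contDiffOn]
  refine (contMDiffOn_of_mem_maximalAtlas hψ).comp (hf.comp
    ((contMDiffOn_symm_of_mem_maximalAtlas hφ).mono inter_subset_left) ?_) ?_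
  · exact fun x hx ↦ hx.2.1
  · exact fun x hx ↦ hx.2.2

section Local

variable {n d : ℕ} {X Y : Type*}
  [TopologicalSpace X] [ChartedSpace (EuclideanSpace ℝ (Fin n)) X] [IsManifold (𝓡 n) ∞ X]
  [TopologicalSpace Y] [ChartedSpace (EuclideanSpace ℝ (Fin d)) Y] [IsManifold (𝓡 d) ∞ Y]

/-- A smooth map with a smooth local section through `p` is a submersion at `p`. -/
theorem isSubmersionAtOfComplement_of_section {f : X → Y} {U : Set X} {p : X} (hU : IsOpen U)
    (hp : p ∈ U) (hf : ContMDiffOn (𝓡 n) (𝓡 d) ∞ f U) {s : Y → X}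
    (hs : ContMDiffAt (𝓡 d) (𝓡 n) ∞ s (f p)) (hsp : s (f p) = p)
    (hfs : ∀ᶠ y in 𝓝 (f p), f (s y) = y) :
    Manifold.IsSubmersionAtOfComplement (EuclideanSpace ℝ (Fin (n - d))) (𝓡 n) (𝓡 d) ∞ f p := by
  let φ := chartAt (EuclideanSpace ℝ (Fin n)) p
  let ψ := chartAt (EuclideanSpace ℝ (Fin d)) (f p)
  have hφ : φ ∈ IsManifold.maximalAtlas (𝓡 n) ∞ X := IsManifold.chart_mem_maximalAtlas p
  have hψ : ψ ∈ IsManifold.maximalAtlas (𝓡 d) ∞ Y := IsManifold.chart_mem_maximalAtlas (f p)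
  have hpφ : p ∈ φ.source := mem_chart_source _ p
  have hpψ : f p ∈ ψ.source := mem_chart_source _ (f p)
  obtain ⟨hO, hF⟩ := hf.contDiffOn_writtenInCharts hU hφ hψ
  set O := φ.target ∩ φ.symm ⁻¹' (U ∩ f ⁻¹' ψ.source)
  set F := ψ ∘ f ∘ φ.symm
  have hpO : φ p ∈ O := ⟨φ.map_source hpφ, by simp [φ.left_inv hpφ, hp, hpψ]⟩
  have hFd : DifferentiableAt ℝ F (φ p) :=
    (hF.contDiffAt (hO.mem_nhds hpO)).differentiableAt (by simp)
  -- the section in charts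
  let S := φ ∘ s ∘ ψ.symm
  have hS0 : S (ψ (f p)) = φ p := by simp [S, ψ.left_inv hpψ, hsp]
  have hSd : DifferentiableAt ℝ S (ψ (f p)) := by
    have h1 : ContMDiffAt (𝓡 d) (𝓡 d) ∞ ψ.symm (ψ (f p)) :=
      contMDiffAt_symm_of_mem_maximalAtlas hψ (ψ.map_source hpψ)
    have h2 : ContMDiffAt (𝓡 d) (𝓡 n) ∞ s (ψ.symm (ψ (f p))) := by rwa [ψ.left_inv hpψ]
    have h3 : ContMDiffAt (𝓡 n) (𝓡 n) ∞ φ (s (ψ.symm (ψ (f p)))) := by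
      rw [ψ.left_inv hpψ, hsp]; exact contMDiffAt_of_mem_maximalAtlas hφ hpφ
    have h4 : ContMDiffAt (𝓡 d) (𝓡 n) ∞ S (ψ (f p)) :=
      ContMDiffAt.comp (ψ (f p)) (f := s ∘ ψ.symm) h3 (h2.comp _ h1)
    exact h4.contDiffAt.differentiableAt (by simp)
  have hFS : F ∘ S =ᶠ[𝓝 (ψ (f p))] id := by
    have hc : Tendsto ψ.symm (𝓝 (ψ (f p))) (𝓝 (f p)) := by
      have := ψ.continuousAt_symm (ψ.map_source hpψ)
      rwa [ContinuousAt, ψ.left_inv hpψ] at this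
    have hsc : Tendsto s (𝓝 (f p)) (𝓝 p) := by
      have := hs.continuousAt
      rwa [ContinuousAt, hsp] at this
    filter_upwards [hc.eventually hfs, ψ.open_target.mem_nhds (ψ.map_source hpψ),
      (hsc.comp hc).eventually (φ.open_source.mem_nhds hpφ)] with y hy hyt hys
    simp only [F, S, Function.comp_apply, id] at hys ⊢
    rw [φ.left_inv hys, hy, ψ.right_inv hyt]
  -- The chain rule for `F ∘ S = id` gives the derivative of `F` a right inverse.
  have hsurj : Function.Surjective (fderiv ℝ F (φ p)) := by
    have h1 : HasFDerivAt (F ∘ S) ((fderiv ℝ F (φ p)).comp (fderiv ℝ S (ψ (f p)))) (ψ (f p)) := by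
      refine HasFDerivAt.comp _ ?_ hSd.hasFDerivAt
      rw [hS0]; exact hFd.hasFDerivAt
    have h2 := (h1.congr_of_eventuallyEq hFS.symm).unique (hasFDerivAt_id _)
    intro v
    exact ⟨fderiv ℝ S (ψ (f p)) v, by simpa using congrArg (fun L ↦ L v) h2⟩
  obtain ⟨A, hA⟩ := (fderiv ℝ F (φ p)).exists_equiv_prod_of_surjective (m := n - d) hsurj (by simp)
  let L : EuclideanSpace ℝ (Fin n) →L[ℝ] EuclideanSpace ℝ (Fin (n - d)) :=
    (ContinuousLinearMap.snd ℝ _ _).comp A.toContinuousLinearMap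
  -- Completing `F` by the linear coordinates `L` gives a local diffeomorphism. In the chart it
  -- defines, `F` is the first projection.
  let Θ : EuclideanSpace ℝ (Fin n) →
    EuclideanSpace ℝ (Fin d) × EuclideanSpace ℝ (Fin (n - d)) := fun u ↦ (F u, L u)
  have hΘ : ContDiffOn ℝ ∞ Θ O := hF.prodMk L.contDiff.contDiffOn
  have hΘ' : HasFDerivAt Θ A.toContinuousLinearMap (φ p) := by
    have hAeq : A.toContinuousLinearMap = (fderiv ℝ F (φ p)).prod L :=
      ContinuousLinearMap.ext fun u ↦ Prod.ext (hA u) rfl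
    rw [hAeq]
    exact hFd.hasFDerivAt.prodMk L.hasFDerivAt
  obtain ⟨e, he, heO, heΘ, hes⟩ := hΘ.exists_openPartialHomeomorph hO hpO hΘ'
  let D := (φ ≫ₕ e) ≫ₕ A.symm.toHomeomorph.toOpenPartialHomeomorph
  have hDs : ∀ x, x ∈ D.source ↔ x ∈ φ.source ∧ φ x ∈ e.source := by
    intro x; simp [D]
  have hDm : D ∈ IsManifold.maximalAtlas (𝓡 n) ∞ X := by
    apply OpenPartialHomeomorph.mem_maximalAtlas_of_contMDiffOn
    · refine (A.symm.contDiff.contMDiff (n := ∞)).comp_contMDiffOn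
        (((hΘ.mono heO).contMDiffOn.congr fun x _ ↦ heΘ x).comp
        ((contMDiffOn_of_mem_maximalAtlas hφ).mono ?_) ?_)
      · exact fun x hx ↦ ((hDs x).1 hx).1
      · exact fun x hx ↦ ((hDs x).1 hx).2
    · have hDt : ∀ y, y ∈ D.target ↔ A y ∈ e.target ∧ e.symm (A y) ∈ φ.target := by
        intro x; simp [D]
      refine (contMDiffOn_symm_of_mem_maximalAtlas hφ).comp (hes.contMDiffOn.comp
        (A.contDiff.contMDiff (n := ∞)).contMDiffOn ?_) ?_
      · exact fun x hx ↦ ((hDt x).1 hx).1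
      · exact fun x hx ↦ ((hDt x).1 hx).2
  refine Manifold.IsSubmersionAtOfComplement.mk_of_charts A D ψ ((hDs p).2 ⟨hpφ, he⟩) hpψ hDm hψ
    ?_ ?_
  · intro x hx
    obtain ⟨h1, h2⟩ := (hDs x).1 hx
    have := (heO h2).2.2
    simpa [φ.left_inv h1] using this
  · intro y hy
    have hy' : y ∈ D.target := by simpa using hy
    have hyt : A y ∈ e.target := by simp [D] at hy'; exact hy'.1
    have h1 : F (e.symm (A y)) = (A y).1 := by
      have := e.right_inv hyt
      rw [heΘ] at this
      exact congrArg Prod.fst this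
    simpa [D, F] using h1

/-- A smooth map with a smooth local left inverse at `p` is an immersion at `p`. -/
theorem isImmersionAtOfComplement_of_leftInverse {f : X → Y} {U : Set X} {p : X} (hU : IsOpen U)
    (hp : p ∈ U) (hf : ContMDiffOn (𝓡 n) (𝓡 d) ∞ f U) {r : Y → X}
    (hr : ContMDiffAt (𝓡 d) (𝓡 n) ∞ r (f p)) (hrf : ∀ᶠ x in 𝓝 p, r (f x) = x) :
    Manifold.IsImmersionAtOfComplement (EuclideanSpace ℝ (Fin (d - n))) (𝓡 n) (𝓡 d) ∞ f p := by
  let φ := chartAt (EuclideanSpace ℝ (Fin n)) p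
  let ψ := chartAt (EuclideanSpace ℝ (Fin d)) (f p)
  have hφ : φ ∈ IsManifold.maximalAtlas (𝓡 n) ∞ X := IsManifold.chart_mem_maximalAtlas p
  have hψ : ψ ∈ IsManifold.maximalAtlas (𝓡 d) ∞ Y := IsManifold.chart_mem_maximalAtlas (f p)
  have hpφ : p ∈ φ.source := mem_chart_source _ p
  have hpψ : f p ∈ ψ.source := mem_chart_source _ (f p)
  obtain ⟨hO, hF⟩ := hf.contDiffOn_writtenInCharts hU hφ hψ
  set O := φ.target ∩ φ.symm ⁻¹' (U ∩ f ⁻¹' ψ.source)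
  set F := ψ ∘ f ∘ φ.symm
  have hpO : φ p ∈ O := ⟨φ.map_source hpφ, by simp [φ.left_inv hpφ, hp, hpψ]⟩
  have hF0 : F (φ p) = ψ (f p) := by simp [F, φ.left_inv hpφ]
  have hFd : DifferentiableAt ℝ F (φ p) :=
    (hF.contDiffAt (hO.mem_nhds hpO)).differentiableAt (by simp)
  -- the left inverse in charts
  have hrp : r (f p) = p := hrf.self_of_nhds
  let R := φ ∘ r ∘ ψ.symm
  have hRd : DifferentiableAt ℝ R (ψ (f p)) := by
    have h1 : ContMDiffAt (𝓡 d) (𝓡 d) ∞ ψ.symm (ψ (f p)) :=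
      contMDiffAt_symm_of_mem_maximalAtlas hψ (ψ.map_source hpψ)
    have h2 : ContMDiffAt (𝓡 d) (𝓡 n) ∞ r (ψ.symm (ψ (f p))) := by rwa [ψ.left_inv hpψ]
    have h3 : ContMDiffAt (𝓡 n) (𝓡 n) ∞ φ (r (ψ.symm (ψ (f p)))) := by
      rw [ψ.left_inv hpψ, hrp]; exact contMDiffAt_of_mem_maximalAtlas hφ hpφ
    have h4 : ContMDiffAt (𝓡 d) (𝓡 n) ∞ R (ψ (f p)) :=
      ContMDiffAt.comp (ψ (f p)) (f := r ∘ ψ.symm) h3 (h2.comp _ h1)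
    exact h4.contDiffAt.differentiableAt (by simp)
  have hRF : R ∘ F =ᶠ[𝓝 (φ p)] id := by
    have hc : Tendsto φ.symm (𝓝 (φ p)) (𝓝 p) := by
      have := φ.continuousAt_symm (φ.map_source hpφ)
      rwa [ContinuousAt, φ.left_inv hpφ] at this
    filter_upwards [hc.eventually hrf, hO.mem_nhds hpO] with y hy hyO
    simp only [F, R, Function.comp_apply, id]
    rw [ψ.left_inv hyO.2.2, hy, φ.right_inv hyO.1]
  have hinj : Function.Injective (fderiv ℝ F (φ p)) := by
    have h1 : HasFDerivAt (R ∘ F) ((fderiv ℝ R (ψ (f p))).comp (fderiv ℝ F (φ p))) (φ p) := by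
      refine HasFDerivAt.comp _ ?_ hFd.hasFDerivAt
      rw [hF0]; exact hRd.hasFDerivAt
    have h2 := (h1.congr_of_eventuallyEq hRF.symm).unique (hasFDerivAt_id _)
    exact Function.LeftInverse.injective (g := fderiv ℝ R (ψ (f p)))
      fun v ↦ by simpa using congrArg (fun L ↦ L v) h2
  obtain ⟨A, hA⟩ := (fderiv ℝ F (φ p)).exists_equiv_prod_of_injective (m := d - n) hinj (by simp)
  let L : EuclideanSpace ℝ (Fin (d - n)) →L[ℝ] EuclideanSpace ℝ (Fin d) :=
    A.toContinuousLinearMap.comp (ContinuousLinearMap.inr ℝ _ _)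
  -- Thickening `F` in the complementary directions `L` gives a local diffeomorphism whose inverse
  -- straightens the image of `F` to `{(u, 0)}`.
  let Θ : EuclideanSpace ℝ (Fin n) × EuclideanSpace ℝ (Fin (d - n)) →
    EuclideanSpace ℝ (Fin d) := fun u ↦ F u.1 + L u.2
  have hΘ : ContDiffOn ℝ ∞ Θ (Prod.fst ⁻¹' O) :=
    (hF.comp contDiff_fst.contDiffOn fun _ h ↦ h).add (L.contDiff.comp contDiff_snd).contDiffOn
  have hΘ' : HasFDerivAt Θ A.toContinuousLinearMap (φ p, 0) := by
    have h1 : HasFDerivAt Θ ((fderiv ℝ F (φ p)).comp (ContinuousLinearMap.fst ℝ _ _) +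
        L.comp (ContinuousLinearMap.snd ℝ _ _)) (φ p, 0) :=
      (HasFDerivAt.comp (φ p, 0) (hFd.hasFDerivAt) hasFDerivAt_fst).add
        (L.hasFDerivAt.comp (φ p, 0) hasFDerivAt_snd)
    convert! h1 using 1
    refine ContinuousLinearMap.ext fun ⟨u, v⟩ ↦ ?_
    have : A (u, v) = A (u, 0) + A (0, v) := by rw [← map_add]; simp
    simp [L, this, hA]
  obtain ⟨e, he, heO, heΘ, hes⟩ :=
    hΘ.exists_openPartialHomeomorph (hO.preimage continuous_fst) hpO hΘ'
  let D := (ψ ≫ₕ e.symm) ≫ₕ A.toHomeomorph.toOpenPartialHomeomorph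
  have hDs : ∀ x, x ∈ D.source ↔ x ∈ ψ.source ∧ ψ x ∈ e.target := by
    intro x; simp [D]
  have hDm : D ∈ IsManifold.maximalAtlas (𝓡 d) ∞ Y := by
    apply OpenPartialHomeomorph.mem_maximalAtlas_of_contMDiffOn
    · refine (A.contDiff.contMDiff (n := ∞)).comp_contMDiffOn
        (hes.contMDiffOn.comp
        ((contMDiffOn_of_mem_maximalAtlas hψ).mono ?_) ?_)
      · exact fun x hx ↦ ((hDs x).1 hx).1
      · exact fun x hx ↦ ((hDs x).1 hx).2
    · have hDt : ∀ y, y ∈ D.target ↔ A.symm y ∈ e.source ∧ e (A.symm y) ∈ ψ.target := by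
        intro x; simp [D]
      refine (contMDiffOn_symm_of_mem_maximalAtlas hψ).comp
        (((hΘ.mono heO).contMDiffOn.congr fun x _ ↦ heΘ x).comp
        (A.symm.contDiff.contMDiff (n := ∞)).contMDiffOn ?_) ?_
      · exact fun x hx ↦ ((hDt x).1 hx).1
      · exact fun x hx ↦ ((hDt x).1 hx).2
  -- The source chart is cut down so that `(φ x, 0)` stays in the domain of `e`.
  let V : Set (EuclideanSpace ℝ (Fin n)) := (fun u ↦ (u, 0)) ⁻¹' e.source
  have hV : IsOpen V := e.open_source.preimage (by fun_prop)
  let C := φ ≫ₕ OpenPartialHomeomorph.ofSet V hV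
  have hCs : ∀ x, x ∈ C.source ↔ x ∈ φ.source ∧
      (φ x, (0 : EuclideanSpace ℝ (Fin (d - n)))) ∈ e.source := by
    intro x; simp [C, V]
  have hCm : C ∈ IsManifold.maximalAtlas (𝓡 n) ∞ X := by
    apply OpenPartialHomeomorph.mem_maximalAtlas_of_contMDiffOn
    · exact (contMDiffOn_of_mem_maximalAtlas hφ).mono fun x hx ↦ ((hCs x).1 hx).1
    · refine (contMDiffOn_symm_of_mem_maximalAtlas hφ).mono fun x hx ↦ ?_
      simp only [C, mfld_simps] at hx
      exact hx.2
  have hmem : ∀ x ∈ C.source, f x ∈ D.source ∧ D (f x) = A (φ x, 0) := by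
    intro x hx
    obtain ⟨h1, h2⟩ := (hCs x).1 hx
    have h3 := (heO h2).2.2
    simp only [mem_preimage, φ.left_inv h1] at h3
    have h4 : ψ (f x) = e (φ x, 0) := by simp [heΘ, Θ, F, φ.left_inv h1]
    refine ⟨(hDs _).2 ⟨h3, h4 ▸ e.map_source h2⟩, ?_⟩
    simp [D, h4, e.left_inv h2]
  have hpC : p ∈ C.source := (hCs p).2 ⟨hpφ, he⟩
  refine Manifold.IsImmersionAtOfComplement.mk_of_charts A C D hpC (hmem p hpC).1 hCm hDm
    (fun x hx ↦ (hmem x hx).1) ?_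
  intro y hy
  have hy' : y ∈ C.target := by simpa using hy
  have h1 := (hmem _ (C.map_target hy')).2
  have h2 : φ (C.symm y) = y := C.right_inv hy'
  rw [h2] at h1
  simpa using h1

end Local

/-! ### Embedded submanifolds from local parametrizations -/

/-- The charted space structure given by a family of charts and a choice of one of them at every
point. -/
abbrev ChartedSpace.ofCharts {ι H Y : Type*} [TopologicalSpace H] [TopologicalSpace Y]
    (φ : ι → OpenPartialHomeomorph Y H) (c : Y → ι) (hc : ∀ y, y ∈ (φ (c y)).source) :
    ChartedSpace H Y where
  atlas := range φ
  chartAt y := φ (c y)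
  mem_chart_source := hc
  chart_mem_atlas y := mem_range_self (c y)

theorem ChartedSpace.isManifold_ofCharts {ι : Type*} {k : ℕ} {Y : Type*} [TopologicalSpace Y]
    (φ : ι → OpenPartialHomeomorph Y (EuclideanSpace ℝ (Fin k))) (c : Y → ι)
    (hc : ∀ y, y ∈ (φ (c y)).source)
    (h : ∀ i j, ContDiffOn ℝ ∞ (φ j ∘ (φ i).symm) ((φ i).target ∩ (φ i).symm ⁻¹' (φ j).source)) :
    letI := ChartedSpace.ofCharts φ c hc
    IsManifold (𝓡 k) ∞ Y := by
  let := ChartedSpace.ofCharts φ c hc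
  apply isManifold_of_contDiffOn
  rintro _ _ ⟨i, rfl⟩ ⟨j, rfl⟩
  simpa using h i j

section

variable {m k : ℕ} {M : Type*} [TopologicalSpace M] [ChartedSpace (EuclideanSpace ℝ (Fin m)) M]

/-- The chart of a subset `S` of `M` obtained by restricting a map `ρ` on `M` which has an inverse
`τ` with values in `S`. -/
theorem exists_openPartialHomeomorph_subtype {E : Type*} [TopologicalSpace E] {S O : Set M}
    {W : Set E} {ρ : M → E} {τ : E → M} (x : S) (hO : IsOpen O) (hW : IsOpen W)
    (hρ : ContinuousOn ρ O) (hτ : ContinuousOn τ W)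
    (hρτ : ∀ y ∈ S, y ∈ O → ρ y ∈ W ∧ τ (ρ y) = y)
    (hτρ : ∀ w ∈ W, τ w ∈ S ∧ τ w ∈ O ∧ ρ (τ w) = w) :
    ∃ φ : OpenPartialHomeomorph S E, φ.source = Subtype.val ⁻¹' O ∧ φ.target = W ∧
      (∀ y : S, φ y = ρ y) ∧ ∀ w ∈ W, (φ.symm w : M) = τ w := by
  classical
  let σ : E → S := fun w ↦ if h : τ w ∈ S then ⟨τ w, h⟩ else x
  have hσ : ∀ w ∈ W, (σ w : M) = τ w := by
    intro w hw
    simp [σ, (hτρ w hw).1]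
  refine ⟨{ toFun := fun y ↦ ρ y, invFun := σ, source := Subtype.val ⁻¹' O, target := W,
            map_source' := fun y hy ↦ (hρτ y y.2 hy).1
            map_target' := fun w hw ↦ by
              simp only [mem_preimage, hσ w hw]; exact (hτρ w hw).2.1
            left_inv' := fun y hy ↦ Subtype.ext <| by
              rw [hσ _ (hρτ y y.2 hy).1]; exact (hρτ y y.2 hy).2
            right_inv' := fun w hw ↦ by
              simp only [hσ w hw]; exact (hτρ w hw).2.2
            open_source := hO.preimage continuous_subtype_val
            open_target := hW
            continuousOn_toFun := hρ.comp continuous_subtype_val.continuousOn fun _ h ↦ h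
            continuousOn_invFun := by
              rw [IsEmbedding.subtypeVal.continuousOn_iff]
              exact hτ.congr hσ }, rfl, rfl, fun _ ↦ rfl, hσ⟩

/-- A subset which is locally parametrized by smooth maps `τ` that are inverse to restrictions of
smooth maps `ρ` on the ambient manifold is an embedded submanifold. -/
theorem isSubmanifold_of_local_parametrization [IsManifold (𝓡 m) ∞ M] (S : Set M)
    (h : ∀ x ∈ S, ∃ (O : Set M) (W : Set (EuclideanSpace ℝ (Fin k)))
      (ρ : M → EuclideanSpace ℝ (Fin k)) (τ : EuclideanSpace ℝ (Fin k) → M),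
      x ∈ O ∧ IsOpen O ∧ IsOpen W ∧ ContMDiffOn (𝓡 m) (𝓡 k) ∞ ρ O ∧
      ContMDiffOn (𝓡 k) (𝓡 m) ∞ τ W ∧ (∀ y ∈ S, y ∈ O → ρ y ∈ W ∧ τ (ρ y) = y) ∧
      ∀ w ∈ W, τ w ∈ S ∧ τ w ∈ O ∧ ρ (τ w) = w) :
    IsSubmanifold m k S := by
  choose O W ρ τ hxO hO hW hρ hτ hρτ hτρ using fun x : S ↦ h x x.2
  choose φ hφs hφt hφ hφi using fun x : S ↦ exists_openPartialHomeomorph_subtype x (hO x) (hW x)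
    (hρ x).continuousOn (hτ x).continuousOn (hρτ x) (hτρ x)
  have hmem : ∀ x, x ∈ (φ x).source := fun x ↦ by rw [hφs]; exact hxO x
  have hsm : ∀ x y, ContDiffOn ℝ ∞ (φ y ∘ (φ x).symm)
      ((φ x).target ∩ (φ x).symm ⁻¹' (φ y).source) := by
    intro x y
    rw [← contMDiffOn_iff_contDiffOn]
    have h1 : ContMDiffOn (𝓡 k) (𝓡 k) ∞ (ρ y ∘ τ x)
        ((φ x).target ∩ (φ x).symm ⁻¹' (φ y).source) := by
      refine (hρ y).comp ((hτ x).mono ?_) ?_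
      · rw [hφt]; exact inter_subset_left
      · rintro w ⟨hw, hw'⟩
        rw [hφt] at hw
        rwa [mem_preimage, hφs, mem_preimage, hφi x w hw] at hw'
    refine h1.congr ?_
    rintro w ⟨hw, -⟩
    rw [hφt] at hw
    simp [hφ, hφi x w hw]
  let cs := ChartedSpace.ofCharts φ id hmem
  have hman : IsManifold (𝓡 k) ∞ S := ChartedSpace.isManifold_ofCharts φ id hmem hsm
  have hatl : ∀ x, φ x ∈ IsManifold.maximalAtlas (𝓡 k) ∞ S := fun x ↦
    IsManifold.subset_maximalAtlas (mem_range_self x)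
  refine ⟨cs, hman, ⟨EuclideanSpace ℝ (Fin (m - k)), inferInstance, inferInstance, fun x ↦ ?_⟩,
    IsEmbedding.subtypeVal⟩
  -- Since `ρ x` is defined on an open set of `M`, following it by the inverse chart gives a smooth
  -- local retraction onto `S`.
  refine isImmersionAtOfComplement_of_leftInverse (r := (φ x).symm ∘ ρ x) (φ x).open_source
    (hmem x) ?_ ?_ ?_
  · refine ((hτ x).comp (contMDiffOn_of_mem_maximalAtlas (hatl x)) ?_).congr ?_
    · intro y hy
      rw [mem_preimage, ← hφt]
      exact (φ x).map_source hy
    · intro y hy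
      rw [Function.comp_apply, ← hφi x _ (hφt x ▸ (φ x).map_source hy), (φ x).left_inv hy]
  · refine (contMDiffAt_symm_of_mem_maximalAtlas (hatl x) ?_).comp _
      ((hρ x).contMDiffAt ((hO x).mem_nhds (hxO x)))
    rw [hφt]
    exact (hρτ x x x.2 (hxO x)).1
  · filter_upwards [(φ x).open_source.mem_nhds (hmem x)] with y hy
    rw [Function.comp_apply, ← hφ, (φ x).left_inv hy]

end

/-! ### Preimages of submanifolds under fiber bundles -/

section

variable {m b f n' : ℕ} {M B F : Type*}
  [TopologicalSpace M] [ChartedSpace (EuclideanSpace ℝ (Fin m)) M]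
  [TopologicalSpace B] [ChartedSpace (EuclideanSpace ℝ (Fin b)) B]
  [TopologicalSpace F] [ChartedSpace (EuclideanSpace ℝ (Fin f)) F]

/-- Near each of its points, an embedded submanifold has a chart which extends to a smooth map on
the ambient manifold. -/
theorem IsSubmanifoldStructure.exists_chart_extension [IsManifold (𝓡 b) ∞ B] {N : Set B}
    [ChartedSpace (EuclideanSpace ℝ (Fin n')) N] (hN : IsSubmanifoldStructure b n' N) (y : N) :
    ∃ (φ : OpenPartialHomeomorph N (EuclideanSpace ℝ (Fin n'))) (V : Set B)
      (ρ : B → EuclideanSpace ℝ (Fin n')), φ ∈ IsManifold.maximalAtlas (𝓡 n') ∞ N ∧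
      y ∈ φ.source ∧ IsOpen V ∧ φ.source = Subtype.val ⁻¹' V ∧
      ContMDiffOn (𝓡 b) (𝓡 n') ∞ ρ V ∧ ∀ z ∈ φ.source, ρ z = φ z := by
  have h := hN.isSmoothEmbedding.isImmersion.isImmersionAt y
  obtain ⟨V, hV, hVs⟩ := isOpen_induced_iff.1 h.domChart.open_source
  -- In the immersion normal form the inclusion is `u ↦ (u, 0)`, so the first coordinate of the
  -- ambient chart extends the chart of `N`.
  let ρ : B → EuclideanSpace ℝ (Fin n') := fun z ↦ (h.equiv.symm (h.codChart z)).1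
  refine ⟨h.domChart, V ∩ h.codChart.source, ρ, h.domChart_mem_maximalAtlas,
    h.mem_domChart_source, hV.inter h.codChart.open_source, ?_, ?_, ?_⟩
  · rw [preimage_inter, hVs, left_eq_inter]
    exact h.source_subset_preimage_source
  · have h1 : ContDiff ℝ ∞ (fun z ↦ (h.equiv.symm z).1) := by fun_prop
    exact h1.contMDiff.comp_contMDiffOn
      ((contMDiffOn_of_mem_maximalAtlas h.codChart_mem_maximalAtlas).mono inter_subset_right)
  · intro z hz
    have h0 : h.domChart z ∈ (h.domChart.extend (𝓡 n')).target := by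
      simpa using h.domChart.map_source hz
    have h1 := h.writtenInCharts h0
    simp only [mfld_simps, h.domChart.left_inv hz, Function.comp_apply] at h1
    simp [ρ, h1]

/-- The preimage of an embedded submanifold under the projection of a smooth fiber bundle is an
embedded submanifold, whose dimension is the sum of the dimensions of the submanifold and the
fiber. -/
theorem IsSmoothFiberBundle.isSubmanifold_preimage [IsManifold (𝓡 m) ∞ M] [IsManifold (𝓡 b) ∞ B]
    [IsManifold (𝓡 f) ∞ F] {π : M → B} (hπ : IsSmoothFiberBundle m b f F π) {N : Set B}
    (hN : IsSubmanifold b n' N) : IsSubmanifold m (n' + f) (π ⁻¹' N) := by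
  obtain ⟨cs, hN⟩ := hN
  have hman := hN.isManifold
  let A : (EuclideanSpace ℝ (Fin n') × EuclideanSpace ℝ (Fin f)) ≃L[ℝ]
    EuclideanSpace ℝ (Fin (n' + f)) := ContinuousLinearEquiv.ofFinrankEq (by simp)
  refine isSubmanifold_of_local_parametrization _ fun x hx ↦ ?_
  obtain ⟨e, hxe, he, hes⟩ := hπ (π x)
  obtain ⟨φ, V, ρ, hφ, hxφ, hV, hφV, hρ, hρφ⟩ := hN.exists_chart_extension ⟨π x, hx⟩
  let χ := chartAt (EuclideanSpace ℝ (Fin f)) (e x).2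
  have hχ : χ ∈ IsManifold.maximalAtlas (𝓡 f) ∞ F := IsManifold.chart_mem_maximalAtlas _
  have hφi := contMDiffOn_symm_of_mem_maximalAtlas hφ
  have hfst : ∀ z ∈ e.source, (e z).1 = π z := fun z hz ↦ e.coe_fst hz
  let O : Set M := e.source ∩ e ⁻¹' (V ×ˢ χ.source)
  let W₀ : Set (EuclideanSpace ℝ (Fin n') × EuclideanSpace ℝ (Fin f)) :=
    (φ.target ∩ φ.symm ⁻¹' (Subtype.val ⁻¹' e.baseSet)) ×ˢ χ.target
  have hW₀ : IsOpen W₀ := (φ.isOpen_inter_preimage_symm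
    (e.open_baseSet.preimage continuous_subtype_val)).prod χ.open_target
  have hsymm : ∀ (z : B) (v : F), z ∈ e.baseSet →
      (z, v) ∈ e.target ∧ e (e.toOpenPartialHomeomorph.symm (z, v)) = (z, v) ∧
      π (e.toOpenPartialHomeomorph.symm (z, v)) = z ∧
      e.toOpenPartialHomeomorph.symm (z, v) ∈ e.source := by
    intro z v hz
    have h1 : (z, v) ∈ e.target := e.mem_target.2 hz
    exact ⟨h1, e.apply_symm_apply h1, e.proj_symm_apply h1,
      e.toOpenPartialHomeomorph.map_target h1⟩
  -- The coordinates of a point are those of its projection in `N` and those of its fiber component.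
  -- Using `ρ` instead of `φ` defines them on an open subset of `M`.
  refine ⟨O, A.symm ⁻¹' W₀, fun z ↦ A (ρ (e z).1, χ (e z).2),
    fun w ↦ e.toOpenPartialHomeomorph.symm ((φ.symm (A.symm w).1 : B), χ.symm (A.symm w).2),
    ?_, ?_, hW₀.preimage A.symm.continuous, ?_, ?_, ?_, ?_⟩
  · have h1 : x ∈ e.source := e.mem_source.2 hxe
    refine ⟨h1, ?_, mem_chart_source _ _⟩
    rw [hfst x h1]
    rw [hφV] at hxφ
    exact hxφ
  · exact e.continuousOn_toFun.isOpen_inter_preimage e.open_source (hV.prod χ.open_source)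
  · refine (A.contDiff.contMDiff (n := ∞)).comp_contMDiffOn (ContMDiffOn.prodMk_space ?_ ?_)
    · exact hρ.comp (contMDiff_fst.comp_contMDiffOn (he.mono inter_subset_left))
        fun z hz ↦ hz.2.1
    · exact (contMDiffOn_of_mem_maximalAtlas hχ).comp
        (contMDiff_snd.comp_contMDiffOn (he.mono inter_subset_left)) fun z hz ↦ hz.2.2
  · refine hes.comp (ContMDiffOn.prodMk ?_ ?_) fun w hw ↦ (hsymm _ _ hw.1.2).1
    · refine hN.isSmoothEmbedding.contMDiff.comp_contMDiffOn (hφi.comp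
        (ContDiff.contMDiff (by fun_prop)).contMDiffOn fun w hw ↦ hw.1.1)
    · exact (contMDiffOn_symm_of_mem_maximalAtlas hχ).comp
        (ContDiff.contMDiff (by fun_prop)).contMDiffOn fun w hw ↦ hw.2
  · intro z hz hzO
    have h1 : (⟨π z, hz⟩ : N) ∈ φ.source := by
      rw [hφV]
      change π z ∈ V
      rw [← hfst z hzO.1]
      exact hzO.2.1
    have h2 : ρ (e z).1 = φ ⟨π z, hz⟩ := by rw [hfst z hzO.1]; exact hρφ _ h1
    have h3 : π z ∈ e.baseSet := e.mem_source.1 hzO.1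
    simp only [mem_preimage, A.symm_apply_apply, h2, φ.left_inv h1, χ.left_inv hzO.2.2]
    refine ⟨⟨⟨φ.map_source h1, ?_⟩, χ.map_source hzO.2.2⟩, ?_⟩
    · simpa only [mem_preimage, φ.left_inv h1] using h3
    · rw [← hfst z hzO.1]
      exact e.toOpenPartialHomeomorph.left_inv hzO.1
  · intro w hw
    obtain ⟨⟨h1, h2⟩, h3⟩ := hw
    obtain ⟨h4, h5, h6, h7⟩ := hsymm _ (χ.symm (A.symm w).2) h2
    have h8 := φ.map_target h1
    refine ⟨?_, ⟨h7, ?_⟩, ?_⟩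
    · rw [mem_preimage, h6]; exact (φ.symm (A.symm w).1).2
    · rw [mem_preimage, h5]
      exact ⟨by rw [hφV] at h8; exact h8, χ.map_target h3⟩
    · simp only [h5, hρφ _ h8, φ.right_inv h1, χ.right_inv h3]
      exact A.apply_symm_apply w

end

/-! ### Orbit maps of free actions are immersions -/

theorem contMDiff_orbitMap (h n : ℕ) (H : Type*) {X : Type*}
    [TopologicalSpace H] [ChartedSpace (EuclideanSpace ℝ (Fin h)) H]
    [TopologicalSpace X] [ChartedSpace (EuclideanSpace ℝ (Fin n)) X]
    [SMul H X] [ContMDiffSMul (𝓡 h) (𝓡 n) ∞ H X] (p : X) :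
    ContMDiff (𝓡 h) (𝓡 n) ∞ (fun a : H ↦ a • p) :=
  (contMDiff_smul (I := 𝓡 h) (I' := 𝓡 n) (n := ∞)).comp (contMDiff_id.prodMk contMDiff_const)

theorem contMDiff_constSMul (h n : ℕ) {H : Type*} (X : Type*)
    [TopologicalSpace H] [ChartedSpace (EuclideanSpace ℝ (Fin h)) H]
    [TopologicalSpace X] [ChartedSpace (EuclideanSpace ℝ (Fin n)) X]
    [SMul H X] [ContMDiffSMul (𝓡 h) (𝓡 n) ∞ H X] (a : H) :
    ContMDiff (𝓡 n) (𝓡 n) ∞ (fun x : X ↦ a • x) :=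
  (contMDiff_smul (I := 𝓡 h) (I' := 𝓡 n) (n := ∞)).comp (contMDiff_const.prodMk contMDiff_id)

/-- A curve with vanishing derivative is locally constant. -/
theorem eventually_eq_of_hasMFDerivAt_zero {n : ℕ} {X : Type*} [TopologicalSpace X]
    [ChartedSpace (EuclideanSpace ℝ (Fin n)) X] [IsManifold (𝓡 n) ∞ X] {γ : ℝ → X} {t₀ : ℝ}
    (hγ : ∀ᶠ t in 𝓝 t₀, HasMFDerivAt 𝓘(ℝ, ℝ) (𝓡 n) γ t 0) : ∀ᶠ t in 𝓝 t₀, γ t = γ t₀ := by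
  let ψ := chartAt (EuclideanSpace ℝ (Fin n)) (γ t₀)
  have hψ : ψ ∈ IsManifold.maximalAtlas (𝓡 n) ∞ X := IsManifold.chart_mem_maximalAtlas _
  have hs : ∀ᶠ t in 𝓝 t₀, γ t ∈ ψ.source :=
    hγ.self_of_nhds.continuousAt.eventually (ψ.open_source.mem_nhds (mem_chart_source _ _))
  obtain ⟨ε, hε, hball⟩ := Metric.eventually_nhds_iff_ball.1 (hγ.and hs)
  have hder : ∀ t ∈ Metric.ball t₀ ε, HasFDerivAt (ψ ∘ γ) (0 : ℝ →L[ℝ] _) t := by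
    intro t ht
    obtain ⟨h1, h2⟩ := hball t ht
    have h3 : MDifferentiableAt (𝓡 n) (𝓡 n) ψ (γ t) :=
      (contMDiffAt_of_mem_maximalAtlas hψ h2).mdifferentiableAt (by simp)
    have h4 := h3.hasMFDerivAt.comp t h1
    rw [hasMFDerivAt_iff_hasFDerivAt] at h4
    exact h4.congr_fderiv
      (ContinuousLinearMap.ext fun c ↦ map_zero (mfderiv (𝓡 n) (𝓡 n) ψ (γ t)))
  filter_upwards [Metric.ball_mem_nhds t₀ hε] with t ht
  have h0 : t₀ ∈ Metric.ball t₀ ε := Metric.mem_ball_self hε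
  have h1 : (ψ ∘ γ) t = (ψ ∘ γ) t₀ :=
    Metric.isOpen_ball.is_const_of_fderiv_eq_zero (𝕜 := ℝ) (convex_ball t₀ ε).isPreconnected
      (fun t ht ↦ (hder t ht).differentiableAt.differentiableWithinAt)
      (fun t ht ↦ (hder t ht).fderiv) ht h0
  exact ψ.injOn (hball t ht).2 (hball t₀ h0).2 h1

section

variable {n h : ℕ} {H X : Type*}
  [Group H] [TopologicalSpace H] [ChartedSpace (EuclideanSpace ℝ (Fin h)) H] [LieGroup (𝓡 h) ∞ H]
  [TopologicalSpace X] [ChartedSpace (EuclideanSpace ℝ (Fin n)) X] [IsManifold (𝓡 n) ∞ X]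
  [MulAction H X] [ContMDiffSMul (𝓡 h) (𝓡 n) ∞ H X]

/-- The orbit map of a free smooth action of a Lie group has an injective derivative. -/
theorem injective_mfderiv_orbitMap {p : X} (hfree : ∀ a : H, a • p = p → a = 1) :
    Function.Injective (mfderiv (𝓡 h) (𝓡 n) (fun a : H ↦ a • p) 1) := by
  rw [injective_iff_map_eq_zero]
  intro v hv
  have : LieGroup (𝓡 h) (minSmoothness ℝ 3) H := by
    rw [minSmoothness_of_isRCLikeNormedField]
    infer_instance
  have : IsManifold (𝓡 h) 1 H := inferInstance
  have hvf := contMDiff_mulInvariantVectorField (I := 𝓡 h) (G := H) v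
  obtain ⟨γ, hγ0, hγ⟩ := exists_isMIntegralCurveAt_of_contMDiffAt_boundaryless (t₀ := (0 : ℝ))
    ((hvf 1).of_le (by rw [minSmoothness_of_isRCLikeNormedField]; exact one_le_two))
  let θ : H → X := fun a ↦ a • p
  have hθ : ContMDiff (𝓡 h) (𝓡 n) ∞ θ := contMDiff_orbitMap h n H p
  have hθd : MDifferentiable (𝓡 h) (𝓡 n) θ := hθ.mdifferentiable (by simp)
  -- Equivariance `θ (a * b) = a • θ b` carries the vanishing at `1` along the whole left-invariant
  -- field.
  have hzero : ∀ a : H, mfderiv (𝓡 h) (𝓡 n) θ a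
      (mulInvariantVectorField (I := 𝓡 h) v a) = 0 := by
    intro a
    have hL : MDifferentiableAt (𝓡 h) (𝓡 h) (fun b : H ↦ a * b) 1 :=
      (contMDiff_mul_left (I := 𝓡 h) (n := ∞) (a := a)).mdifferentiable (by simp) 1
    have hS : MDifferentiableAt (𝓡 n) (𝓡 n) (fun x : X ↦ a • x) (θ 1) :=
      (contMDiff_constSMul h n X a).mdifferentiable (by simp) _
    have h1 := ((hθd (a * 1)).hasMFDerivAt.comp 1 hL.hasMFDerivAt)
    have h2 := hS.hasMFDerivAt.comp 1 (hθd 1).hasMFDerivAt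
    have h3 : θ ∘ (fun b : H ↦ a * b) = (fun x : X ↦ a • x) ∘ θ := by
      ext b; simp [θ, mul_smul]
    rw [h3] at h1
    have h4 := DFunLike.congr_fun (hasMFDerivAt_unique h1 h2) v
    have h5 : mfderiv (𝓡 h) (𝓡 n) θ (a * 1)
      (mfderiv (𝓡 h) (𝓡 h) (fun b : H ↦ a * b) 1 v) = 0 := by
      refine h4.trans ?_
      change mfderiv (𝓡 n) (𝓡 n) (fun x : X ↦ a • x) (θ 1) (mfderiv (𝓡 h) (𝓡 n) θ 1 v) = 0
      rw [hv]
      exact map_zero _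
    rw [mul_one] at h5
    exact h5
  -- The curve `θ ∘ γ` has zero velocity, hence is locally constant, and freeness passes this on to
  -- `γ`.
  have hconst : ∀ᶠ t in 𝓝 (0 : ℝ), γ t = γ 0 := by
    have h1 : ∀ᶠ t in 𝓝 (0 : ℝ), HasMFDerivAt 𝓘(ℝ, ℝ) (𝓡 n) (θ ∘ γ) t 0 := by
      filter_upwards [hγ] with t ht
      have h2 := (hθd (γ t)).hasMFDerivAt.comp t ht
      let L : EuclideanSpace ℝ (Fin h) →L[ℝ] EuclideanSpace ℝ (Fin n) :=
        mfderiv (𝓡 h) (𝓡 n) θ (γ t)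
      let w : EuclideanSpace ℝ (Fin h) := mulInvariantVectorField (I := 𝓡 h) v (γ t)
      have hLw : L w = 0 := hzero (γ t)
      refine h2.congr_mfderiv (ContinuousLinearMap.ext fun c ↦ ?_)
      let r : ℝ := c
      change L (r • w) = 0
      rw [map_smul, hLw, smul_zero]
    filter_upwards [eventually_eq_of_hasMFDerivAt_zero h1] with t ht
    have h2 : ((γ 0)⁻¹ * γ t) • p = p := by
      rw [mul_smul, inv_smul_eq_iff]; exact ht
    exact (inv_mul_eq_one.1 (hfree _ h2)).symm
  have h1 : HasMFDerivAt 𝓘(ℝ, ℝ) (𝓡 h) γ 0 0 :=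
    (hasMFDerivAt_const (γ 0) (0 : ℝ)).congr_of_eventuallyEq hconst
  have h2 := DFunLike.congr_fun (hasMFDerivAt_unique hγ.self_of_nhds h1) (1 : ℝ)
  have h3 : mulInvariantVectorField (I := 𝓡 h) v (γ 0) = 0 := by
    refine Eq.trans ?_ h2
    exact (one_smul ℝ _).symm
  rw [hγ0] at h3
  have h4 : mfderiv (𝓡 h) (𝓡 h) (fun b : H ↦ 1 * b) 1 v = 0 := h3
  have h5 : (fun b : H ↦ 1 * b) = id := by ext; simp
  rw [h5, mfderiv_id] at h4
  exact h4

end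

/-! ### Slices for free actions of compact groups -/

section

variable {n h : ℕ} {H X : Type*}
  [Group H] [TopologicalSpace H] [ChartedSpace (EuclideanSpace ℝ (Fin h)) H] [LieGroup (𝓡 h) ∞ H]
  [TopologicalSpace X] [ChartedSpace (EuclideanSpace ℝ (Fin n)) X] [IsManifold (𝓡 n) ∞ X]
  [MulAction H X] [ContMDiffSMul (𝓡 h) (𝓡 n) ∞ H X]

/-- The manifold derivative at `1` is the derivative of the expression in the preferred charts. This
moves injectivity to Euclidean space, where the inverse function theorem is applied. -/
theorem exists_hasFDerivAt_orbitMap {p : X} (hfree : ∀ a : H, a • p = p → a = 1) :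
    ∃ T : EuclideanSpace ℝ (Fin h) →L[ℝ] EuclideanSpace ℝ (Fin n), Function.Injective T ∧
      HasFDerivAt (fun v ↦ chartAt (EuclideanSpace ℝ (Fin n)) p
        ((chartAt (EuclideanSpace ℝ (Fin h)) (1 : H)).symm v • p)) T
        (chartAt (EuclideanSpace ℝ (Fin h)) (1 : H) 1) := by
  have h1 := ((contMDiff_orbitMap h n H p).mdifferentiable (by simp) 1).hasMFDerivAt.2
  refine ⟨mfderiv (𝓡 h) (𝓡 n) (fun a : H ↦ a • p) 1, injective_mfderiv_orbitMap hfree,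
    hasFDerivWithinAt_univ.1 ?_⟩
  simp only [writtenInExtChartAt, Function.comp_def, mfld_simps, one_smul] at h1
  exact h1

/-- The map `(v, w) ↦ c⁻¹ v • σ w`, read in charts, is a local diffeomorphism when `σ` parametrizes
a submanifold transverse to the orbit of `p`. -/
theorem exists_transverse_openPartialHomeomorph {p : X} (hfree : ∀ a : H, a • p = p → a = 1) :
    ∃ (B : EuclideanSpace ℝ (Fin (n - h)) →L[ℝ] EuclideanSpace ℝ (Fin n))
      (e : OpenPartialHomeomorph (EuclideanSpace ℝ (Fin h) × EuclideanSpace ℝ (Fin (n - h)))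
        (EuclideanSpace ℝ (Fin n))),
      letI c := chartAt (EuclideanSpace ℝ (Fin h)) (1 : H)
      letI ψ := chartAt (EuclideanSpace ℝ (Fin n)) p
      (c 1, 0) ∈ e.source ∧ ContDiffOn ℝ ∞ e.symm e.target ∧
      ∀ x ∈ e.source, x.1 ∈ c.target ∧ ψ p + B x.2 ∈ ψ.target ∧
        c.symm x.1 • ψ.symm (ψ p + B x.2) ∈ ψ.source ∧
        e x = ψ (c.symm x.1 • ψ.symm (ψ p + B x.2)) := by
  let c := chartAt (EuclideanSpace ℝ (Fin h)) (1 : H)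
  let ψ := chartAt (EuclideanSpace ℝ (Fin n)) p
  have hc : c ∈ IsManifold.maximalAtlas (𝓡 h) ∞ H := IsManifold.chart_mem_maximalAtlas _
  have hψ : ψ ∈ IsManifold.maximalAtlas (𝓡 n) ∞ X := IsManifold.chart_mem_maximalAtlas _
  have h1c : (1 : H) ∈ c.source := mem_chart_source _ _
  have hpψ : p ∈ ψ.source := mem_chart_source _ _
  obtain ⟨T, hTinj, hT⟩ := exists_hasFDerivAt_orbitMap (h := h) (n := n) hfree
  obtain ⟨A, hA⟩ := T.exists_equiv_prod_of_injective (m := n - h) hTinj (by simp)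
  let B : EuclideanSpace ℝ (Fin (n - h)) →L[ℝ] EuclideanSpace ℝ (Fin n) :=
    A.toContinuousLinearMap.comp (ContinuousLinearMap.inr ℝ _ _)
  let g : EuclideanSpace ℝ (Fin h) × EuclideanSpace ℝ (Fin (n - h)) → X :=
    fun x ↦ c.symm x.1 • ψ.symm (ψ p + B x.2)
  let O₁ : Set (EuclideanSpace ℝ (Fin h) × EuclideanSpace ℝ (Fin (n - h))) :=
    Prod.fst ⁻¹' c.target ∩ (fun x ↦ ψ p + B x.2) ⁻¹' ψ.target
  have hO₁ : IsOpen O₁ := (c.open_target.preimage continuous_fst).inter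
    (ψ.open_target.preimage (by fun_prop))
  have hg : ContMDiffOn 𝓘(ℝ, EuclideanSpace ℝ (Fin h) × EuclideanSpace ℝ (Fin (n - h)))
      (𝓡 n) ∞ g O₁ := by
    refine (contMDiff_smul (I := 𝓡 h) (I' := 𝓡 n) (n := ∞)).comp_contMDiffOn
      (ContMDiffOn.prodMk ?_ ?_)
    · exact (contMDiffOn_symm_of_mem_maximalAtlas hc).comp
        (ContDiff.contMDiff (by fun_prop)).contMDiffOn fun x hx ↦ hx.1
    · exact (contMDiffOn_symm_of_mem_maximalAtlas hψ).comp
        (ContDiff.contMDiff (by fun_prop)).contMDiffOn fun x hx ↦ hx.2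
  let O := O₁ ∩ g ⁻¹' ψ.source
  have hO : IsOpen O := hg.continuousOn.isOpen_inter_preimage hO₁ ψ.open_source
  let Φ := ψ ∘ g
  have hΦ : ContDiffOn ℝ ∞ Φ O := by
    rw [← contMDiffOn_iff_contDiffOn]
    exact (contMDiffOn_of_mem_maximalAtlas hψ).comp (hg.mono inter_subset_left) fun x hx ↦ hx.2
  have hg0 : ∀ v, g (v, 0) = c.symm v • p := by
    intro v; simp [g, ψ.left_inv hpψ]
  have h0O : (c 1, (0 : EuclideanSpace ℝ (Fin (n - h)))) ∈ O := by
    refine ⟨⟨c.map_source h1c, ?_⟩, ?_⟩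
    · simpa using ψ.map_source hpψ
    · simpa [hg0, c.left_inv h1c] using hpψ
  have hΦd : DifferentiableAt ℝ Φ (c 1, 0) :=
    (hΦ.contDiffAt (hO.mem_nhds h0O)).differentiableAt (by simp)
  -- Along `w = 0`, `Φ` is the orbit map, with derivative `T`. Along `v = c 1` the group element is
  -- `1` and `Φ` is affine, with linear part `B`. Together these make up `A`.
  have hΦ' : HasFDerivAt Φ A.toContinuousLinearMap (c 1, 0) := by
    set D := fderiv ℝ Φ (c 1, 0) with hD
    have hl : D.comp (ContinuousLinearMap.inl ℝ _ _) = T := by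
      have h1 : HasFDerivAt (fun v ↦ Φ (v, 0)) (D.comp (ContinuousLinearMap.inl ℝ _ _)) (c 1) :=
        HasFDerivAt.comp (g := Φ) (f := fun v ↦ (v, 0)) (c 1) hΦd.hasFDerivAt (hasFDerivAt_prodMk_left _ _)
      refine h1.unique ?_
      have h2 : (fun v ↦ Φ (v, 0)) = fun v ↦ ψ (c.symm v • p) := by
        ext1 v; simp only [Φ, Function.comp_apply, hg0]
      rw [h2]
      exact hT
    have hr : D.comp (ContinuousLinearMap.inr ℝ _ _) = B := by
      have h1 : HasFDerivAt (fun w ↦ Φ (c 1, w)) (D.comp (ContinuousLinearMap.inr ℝ _ _)) 0 :=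
        HasFDerivAt.comp (g := Φ) (f := fun w ↦ (c 1, w)) 0 hΦd.hasFDerivAt
          (hasFDerivAt_prodMk_right _ _)
      refine h1.unique ?_
      have h2 : (fun w ↦ Φ (c 1, w)) =ᶠ[𝓝 0] fun w ↦ ψ p + B w := by
        have h3 : ∀ᶠ w in 𝓝 (0 : EuclideanSpace ℝ (Fin (n - h))), ψ p + B w ∈ ψ.target := by
          refine (ψ.open_target.preimage (f := fun w ↦ ψ p + B w) (by fun_prop)).mem_nhds ?_
          simpa using ψ.map_source hpψ
        filter_upwards [h3] with w hw
        simp [Φ, g, c.left_inv h1c, ψ.right_inv hw]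
      exact (B.hasFDerivAt.const_add (ψ p)).congr_of_eventuallyEq h2
    have hDA : D = A.toContinuousLinearMap := by
      refine ContinuousLinearMap.ext fun ⟨v, w⟩ ↦ ?_
      have h1 : (v, w) = (v, (0 : EuclideanSpace ℝ (Fin (n - h)))) +
        ((0 : EuclideanSpace ℝ (Fin h)), w) := by simp
      rw [h1, map_add, map_add]
      congr 1
      · exact (DFunLike.congr_fun hl v).trans (hA v).symm
      · exact DFunLike.congr_fun hr w
    rw [← hDA]
    exact hΦd.hasFDerivAt
  obtain ⟨e, he, heO, heΦ, hes⟩ := hΦ.exists_openPartialHomeomorph hO h0O hΦ'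
  exact ⟨B, e, he, hes, fun x hx ↦ ⟨(heO hx).1.1, (heO hx).1.2, (heO hx).2, heΦ x⟩⟩

/-- Orbits of a free smooth action of a compact Lie group have slices: near each point, the orbit
relation is given by a smooth map `r` with a smooth section `σ`. -/
theorem exists_slice [CompactSpace H] [T2Space X] {p : X} (hfree : ∀ a : H, a • p = p → a = 1) :
    ∃ (U : Set X) (W : Set (EuclideanSpace ℝ (Fin (n - h))))
      (r : X → EuclideanSpace ℝ (Fin (n - h))) (σ : EuclideanSpace ℝ (Fin (n - h)) → X),
      p ∈ U ∧ IsOpen U ∧ IsOpen W ∧ ContMDiffOn (𝓡 n) (𝓡 (n - h)) ∞ r U ∧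
      ContMDiffOn (𝓡 (n - h)) (𝓡 n) ∞ σ W ∧ σ (r p) = p ∧ (∀ x ∈ U, r x ∈ W) ∧
      (∀ w ∈ W, σ w ∈ U ∧ r (σ w) = w) ∧
      ∀ x ∈ U, ∀ y, MulAction.orbitRel H X x y ↔ y ∈ U ∧ r x = r y := by
  classical
  have hcs : ContinuousSMul H X := ContMDiffSMul.continuousSMul (I := 𝓡 h) (I' := 𝓡 n) ∞
  obtain ⟨B, e, he0, hes, he⟩ := exists_transverse_openPartialHomeomorph (h := h) (n := n) hfree
  set c := chartAt (EuclideanSpace ℝ (Fin h)) (1 : H)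
  set ψ := chartAt (EuclideanSpace ℝ (Fin n)) p
  have hψ : ψ ∈ IsManifold.maximalAtlas (𝓡 n) ∞ X := IsManifold.chart_mem_maximalAtlas _
  have h1c : (1 : H) ∈ c.source := mem_chart_source _ _
  have hpψ : p ∈ ψ.source := mem_chart_source _ _
  let σ : EuclideanSpace ℝ (Fin (n - h)) → X := fun w ↦ ψ.symm (ψ p + B w)
  have hσ0 : σ 0 = p := by simp [σ, ψ.left_inv hpψ]
  let W₁ : Set (EuclideanSpace ℝ (Fin (n - h))) := (fun w ↦ (c 1, w)) ⁻¹' e.source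
  have hW₁ : IsOpen W₁ := e.open_source.preimage (by fun_prop)
  have hW₁ψ : ∀ w ∈ W₁, ψ p + B w ∈ ψ.target := fun w hw ↦ (he _ hw).2.1
  have hσ : ContMDiffOn (𝓡 (n - h)) (𝓡 n) ∞ σ W₁ :=
    (contMDiffOn_symm_of_mem_maximalAtlas hψ).comp
      (ContDiff.contMDiff (by fun_prop)).contMDiffOn hW₁ψ
  have he1 : ∀ w ∈ W₁, e (c 1, w) = ψ (σ w) := by
    intro w hw
    rw [(he _ hw).2.2.2, c.left_inv h1c, one_smul]
  have hσc : ContinuousAt σ 0 := hσ.continuousOn.continuousAt (hW₁.mem_nhds he0)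
  -- distinct points of a small slice lie in distinct orbits
  have hsep : ∀ᶠ z : EuclideanSpace ℝ (Fin (n - h)) × EuclideanSpace ℝ (Fin (n - h)) in 𝓝 (0, 0),
      ∀ a ∈ (univ : Set H), a • σ z.1 = σ z.2 → z.1 = z.2 := by
    -- Compactness of `H` reduces the claim to a neighbourhood of each `a`. Near `1` it follows from
    -- injectivity of `e`; near `a ≠ 1`, the distinct points `a • p` and `p` have disjoint
    -- neighbourhoods.
    refine isCompact_univ.eventually_forall_of_forall_eventually fun a _ ↦ ?_
    have ht1 : Tendsto (fun q : (EuclideanSpace ℝ (Fin (n - h)) ×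
        EuclideanSpace ℝ (Fin (n - h))) × H ↦ q.1.1) (𝓝 ((0, 0), a)) (𝓝 0) :=
      Continuous.tendsto' (by fun_prop) _ _ rfl
    have ht2 : Tendsto (fun q : (EuclideanSpace ℝ (Fin (n - h)) ×
        EuclideanSpace ℝ (Fin (n - h))) × H ↦ q.1.2) (𝓝 ((0, 0), a)) (𝓝 0) :=
      Continuous.tendsto' (by fun_prop) _ _ rfl
    have ht3 : Tendsto (fun q : (EuclideanSpace ℝ (Fin (n - h)) ×
        EuclideanSpace ℝ (Fin (n - h))) × H ↦ q.2) (𝓝 ((0, 0), a)) (𝓝 a) :=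
      Continuous.tendsto' (by fun_prop) _ _ rfl
    by_cases ha : a = 1
    · subst ha
      have ht4 : Tendsto (fun q : (EuclideanSpace ℝ (Fin (n - h)) ×
          EuclideanSpace ℝ (Fin (n - h))) × H ↦ (c q.2, q.1.1)) (𝓝 ((0, 0), 1)) (𝓝 (c 1, 0)) :=
        ((c.continuousAt h1c).tendsto.comp ht3).prodMk_nhds ht1
      filter_upwards [ht3.eventually (c.open_source.mem_nhds h1c),
        ht2.eventually (hW₁.mem_nhds he0), ht4.eventually (e.open_source.mem_nhds he0)]
        with q hq1 hq2 hq3 hq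
      have h1 : e (c q.2, q.1.1) = e (c 1, q.1.2) := by
        rw [(he _ hq3).2.2.2, he1 _ hq2, c.left_inv hq1, ← hq]
      exact congrArg Prod.snd (e.injOn hq3 hq2 h1)
    · have h1 : a • p ≠ p := fun h ↦ ha (hfree a h)
      have h2 : Tendsto (fun q : (EuclideanSpace ℝ (Fin (n - h)) ×
          EuclideanSpace ℝ (Fin (n - h))) × H ↦ q.2 • σ q.1.1) (𝓝 ((0, 0), a)) (𝓝 (a • p)) :=
        ht3.smul (hσ0 ▸ hσc.tendsto.comp ht1)
      have h3 : Tendsto (fun q : (EuclideanSpace ℝ (Fin (n - h)) ×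
          EuclideanSpace ℝ (Fin (n - h))) × H ↦ σ q.1.2) (𝓝 ((0, 0), a)) (𝓝 p) :=
        hσ0 ▸ hσc.tendsto.comp ht2
      filter_upwards [(h2.prodMk_nhds h3).eventually_mem (isClosed_diagonal.isOpen_compl.mem_nhds h1)]
        with q hq hq'
      exact absurd hq' hq
  obtain ⟨W₂, W₃, hW₂, h0W₂, hW₃, h0W₃, hsep⟩ := mem_nhds_prod_iff'.1 hsep
  let W := W₁ ∩ (W₂ ∩ W₃)
  have hW : IsOpen W := hW₁.inter (hW₂.inter hW₃)
  have h0W : 0 ∈ W := ⟨he0, h0W₂, h0W₃⟩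
  have hinj : ∀ w ∈ W, ∀ w' ∈ W, ∀ a : H, a • σ w = σ w' → w = w' := fun w hw w' hw' a h ↦
    hsep (mk_mem_prod hw.2.1 hw'.2.2) a (mem_univ a) h
  -- `U` is the union of the orbits through the slice. By `hinj` each of them meets the slice once,
  -- and `r` records where; its value `0` off `U` plays no role.
  let U : Set X := {x | ∃ (a : H) (w : EuclideanSpace ℝ (Fin (n - h))), w ∈ W ∧ x = a • σ w}
  let r : X → EuclideanSpace ℝ (Fin (n - h)) := fun x ↦
    if hx : ∃ w ∈ W, ∃ a : H, x = a • σ w then hx.choose else 0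
  have hr : ∀ (a : H), ∀ w ∈ W, r (a • σ w) = w := by
    intro a w hw
    have hx : ∃ w' ∈ W, ∃ a' : H, a • σ w = a' • σ w' := ⟨w, hw, a, rfl⟩
    obtain ⟨h1, a', h2⟩ := hx.choose_spec
    simp only [r, dif_pos hx]
    refine hinj _ h1 w hw (a⁻¹ * a') ?_
    rw [mul_smul, ← h2, inv_smul_smul]
  -- near a point of `U`, the map `r` is the second component of the inverse of `e`
  have hloc : ∀ x ∈ U, (∀ᶠ y in 𝓝 x, y ∈ U) ∧ ContMDiffAt (𝓡 n) (𝓡 (n - h)) ∞ r x := by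
    rintro x ⟨a, w, hw, rfl⟩
    have hwe : (c 1, w) ∈ e.source := hw.1
    have hσψ : σ w ∈ ψ.source := ψ.map_target (hW₁ψ w hw.1)
    have hin : a⁻¹ • a • σ w = σ w := inv_smul_smul a _
    have hψt : ψ (σ w) ∈ e.target := he1 w hw.1 ▸ e.map_source hwe
    have hsymm : e.symm (ψ (σ w)) = (c 1, w) := by rw [← he1 w hw.1, e.left_inv hwe]
    -- Translating by `a⁻¹` brings the point back to the slice, where `e` is available.
    let κ : X → EuclideanSpace ℝ (Fin h) × EuclideanSpace ℝ (Fin (n - h)) :=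
      fun y ↦ e.symm (ψ (a⁻¹ • y))
    have h1 : ContMDiffAt (𝓡 n) (𝓡 n) ∞ (fun y : X ↦ a⁻¹ • y) (a • σ w) :=
      contMDiff_constSMul h n X a⁻¹ _
    have h2 : ContMDiffAt (𝓡 n) (𝓡 n) ∞ (fun y : X ↦ ψ (a⁻¹ • y)) (a • σ w) := by
      refine ContMDiffAt.comp (a • σ w) (g := ψ) (f := fun y : X ↦ a⁻¹ • y) ?_ h1
      rw [hin]
      exact contMDiffAt_of_mem_maximalAtlas hψ hσψ
    have h3 : ContMDiffAt (𝓡 n)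
        𝓘(ℝ, EuclideanSpace ℝ (Fin h) × EuclideanSpace ℝ (Fin (n - h))) ∞ κ (a • σ w) := by
      refine ContMDiffAt.comp (a • σ w) (g := e.symm) (f := fun y : X ↦ ψ (a⁻¹ • y)) ?_ h2
      rw [hin]
      exact (hes.contDiffAt (e.open_target.mem_nhds hψt)).contMDiffAt
    have hκ0 : κ (a • σ w) = (c 1, w) := by simp only [κ]; rw [hin, hsymm]
    have hev : ∀ᶠ y in 𝓝 (a • σ w), y ∈ U ∧ r y = (κ y).2 := by
      have e1 : ∀ᶠ y in 𝓝 (a • σ w), a⁻¹ • y ∈ ψ.source :=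
        h1.continuousAt.eventually_mem (ψ.open_source.mem_nhds (by simpa only [hin]))
      have e2 : ∀ᶠ y in 𝓝 (a • σ w), ψ (a⁻¹ • y) ∈ e.target :=
        h2.continuousAt.eventually_mem (e.open_target.mem_nhds (by simpa only [hin]))
      have e3 : ∀ᶠ y in 𝓝 (a • σ w), (κ y).2 ∈ W :=
        (continuousAt_snd.comp h3.continuousAt).eventually_mem
          (hW.mem_nhds (by rw [Function.comp_apply, hκ0]; exact hw))
      filter_upwards [e1, e2, e3] with y hy1 hy2 hy3
      have hs := he _ (e.map_target hy2)
      have h4 : c.symm (κ y).1 • σ (κ y).2 = a⁻¹ • y := by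
        refine ψ.injOn hs.2.2.1 hy1 ?_
        rw [← hs.2.2.2, e.right_inv hy2]
      have h5 : y = (a * c.symm (κ y).1) • σ (κ y).2 := by
        rw [mul_smul, h4, smul_inv_smul]
      refine ⟨⟨_, _, hy3, h5⟩, ?_⟩
      conv_lhs => rw [h5]
      exact hr _ _ hy3
    refine ⟨hev.mono fun y hy ↦ hy.1, ?_⟩
    exact (contDiff_snd.contMDiff.contMDiffAt.comp _ h3).congr_of_eventuallyEq
      (hev.mono fun y hy ↦ hy.2)
  refine ⟨U, W, r, σ, ⟨1, 0, h0W, by rw [hσ0, one_smul]⟩, ?_, hW, ?_, hσ.mono inter_subset_left,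
    ?_, ?_, ?_, ?_⟩
  · exact isOpen_iff_mem_nhds.2 fun x hx ↦ (hloc x hx).1
  · exact fun x hx ↦ (hloc x hx).2.contMDiffWithinAt
  · have h1 := hr 1 0 h0W
    rw [one_smul, hσ0] at h1
    rw [h1, hσ0]
  · rintro x ⟨a, w, hw, rfl⟩
    rwa [hr a w hw]
  · intro w hw
    refine ⟨⟨1, w, hw, (one_smul _ _).symm⟩, ?_⟩
    have h1 := hr 1 w hw
    rwa [one_smul] at h1
  · rintro x ⟨a, w, hw, rfl⟩ y
    rw [MulAction.orbitRel_apply, hr a w hw]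
    constructor
    · rintro ⟨b, hb⟩
      have h1 : y = (b⁻¹ * a) • σ w := by
        rw [mul_smul, ← hb]; exact (inv_smul_smul b y).symm
      exact ⟨⟨_, w, hw, h1⟩, by rw [h1, hr _ w hw]⟩
    · rintro ⟨⟨b, w', hw', rfl⟩, h1⟩
      rw [hr b w' hw'] at h1
      subst h1
      exact ⟨a * b⁻¹, by simp [mul_smul]⟩

end

/-! ### Quotient manifolds -/

/-- The quotient of a manifold by an equivalence relation which is locally given by smooth maps with
smooth sections is a manifold. -/
theorem exists_isQuotientManifold_of_slices {n d : ℕ} {X : Type*} [TopologicalSpace X]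
    [ChartedSpace (EuclideanSpace ℝ (Fin n)) X] [IsManifold (𝓡 n) ∞ X] [SecondCountableTopology X]
    (s : Setoid X) [T2Space (Quotient s)] (hs : IsOpenMap (Quotient.mk s))
    (h : ∀ p : X, ∃ (U : Set X) (W : Set (EuclideanSpace ℝ (Fin d)))
      (r : X → EuclideanSpace ℝ (Fin d)) (σ : EuclideanSpace ℝ (Fin d) → X),
      p ∈ U ∧ IsOpen U ∧ IsOpen W ∧ ContMDiffOn (𝓡 n) (𝓡 d) ∞ r U ∧
      ContMDiffOn (𝓡 d) (𝓡 n) ∞ σ W ∧ σ (r p) = p ∧ (∀ x ∈ U, r x ∈ W) ∧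
      (∀ w ∈ W, σ w ∈ U ∧ r (σ w) = w) ∧ ∀ x ∈ U, ∀ y, s x y ↔ y ∈ U ∧ r x = r y) :
    ∃ _ : ChartedSpace (EuclideanSpace ℝ (Fin d)) (Quotient s), IsQuotientManifold n d s := by
  choose U W r σ hpU hU hW hr hσ hσr hrW hσU hrel using h
  let q : X → Quotient s := Quotient.mk s
  have hq : Continuous q := continuous_quot_mk
  have hUsat : ∀ p x, q x ∈ q '' U p → x ∈ U p := by
    rintro p x ⟨y, hy, hyx⟩
    exact ((hrel p y hy x).1 (Quotient.exact hyx)).1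
  have hout : ∀ p, ∀ x ∈ U p, r p (q x).out = r p x := fun p x hx ↦
    ((hrel p x hx _).1 (Setoid.symm (Quotient.exact (Quotient.out_eq (q x))))).2.symm
  -- The sets `U p` are saturated and `r p` is constant on classes in them, so the representative
  -- chosen by `out` does not matter.
  let φ : X → OpenPartialHomeomorph (Quotient s) (EuclideanSpace ℝ (Fin d)) := fun p ↦
    { toFun := fun y ↦ r p y.out
      invFun := fun w ↦ q (σ p w)
      source := q '' U p
      target := W p
      map_source' := by
        rintro _ ⟨x, hx, rfl⟩
        rw [hout p x hx]
        exact hrW p x hx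
      map_target' := fun w hw ↦ mem_image_of_mem q (hσU p w hw).1
      left_inv' := by
        rintro _ ⟨x, hx, rfl⟩
        rw [hout p x hx]
        have h1 := hσU p (r p x) (hrW p x hx)
        exact Quotient.sound ((hrel p _ h1.1 x).2 ⟨hx, h1.2⟩)
      right_inv' := fun w hw ↦ by
        rw [hout p _ (hσU p w hw).1]
        exact (hσU p w hw).2
      open_source := hs _ (hU p)
      open_target := hW p
      continuousOn_toFun := by
        rintro _ ⟨x, hx, rfl⟩
        refine ContinuousAt.continuousWithinAt ?_
        rw [ContinuousAt, hout p x hx, ← hs.map_nhds_eq hq.continuousAt, tendsto_map'_iff]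
        refine ((hr p).continuousOn.continuousAt ((hU p).mem_nhds hx)).tendsto.congr' ?_
        filter_upwards [(hU p).mem_nhds hx] with y hy
        exact (hout p y hy).symm
      continuousOn_invFun := hq.comp_continuousOn (hσ p).continuousOn }
  have hφ : ∀ p, ∀ x ∈ U p, φ p (q x) = r p x := hout
  have hmem : ∀ y : Quotient s, y ∈ (φ y.out).source := fun y ↦
    ⟨y.out, hpU _, Quotient.out_eq y⟩
  have hsm : ∀ i j, ContDiffOn ℝ ∞ (φ j ∘ (φ i).symm)
      ((φ i).target ∩ (φ i).symm ⁻¹' (φ j).source) := by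
    intro i j
    rw [← contMDiffOn_iff_contDiffOn]
    refine ((hr j).comp ((hσ i).mono inter_subset_left) ?_).congr ?_
    · exact fun w hw ↦ hUsat j _ hw.2
    · exact fun w hw ↦ hφ j _ (hUsat j _ hw.2)
  let cs := ChartedSpace.ofCharts φ Quotient.out hmem
  have hman : IsManifold (𝓡 d) ∞ (Quotient s) := ChartedSpace.isManifold_ofCharts φ _ hmem hsm
  have hatl : ∀ p, φ p ∈ IsManifold.maximalAtlas (𝓡 d) ∞ (Quotient s) := fun p ↦
    IsManifold.subset_maximalAtlas (mem_range_self p)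
  refine ⟨cs, inferInstance, TopologicalSpace.Quotient.secondCountableTopology hs, hman,
    EuclideanSpace ℝ (Fin (n - d)), inferInstance, inferInstance, fun p ↦ ?_⟩
  have hqp : q p ∈ (φ p).source := mem_image_of_mem q (hpU p)
  -- The slice, read through the chart, is a smooth local section of `q`. It passes through `p`
  -- itself because `σ (r p) = p` for the slice at `p`.
  refine isSubmersionAtOfComplement_of_section (s := σ p ∘ φ p) (hU p) (hpU p) ?_ ?_ ?_ ?_
  · refine ((contMDiffOn_symm_of_mem_maximalAtlas (hatl p)).comp (hr p) (hrW p)).congr ?_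
    intro x hx
    rw [Function.comp_apply, ← hφ p x hx]
    exact ((φ p).left_inv (mem_image_of_mem q hx)).symm
  · exact ((hσ p).contMDiffAt ((hW p).mem_nhds ((φ p).map_source hqp))).comp _
      (contMDiffAt_of_mem_maximalAtlas (hatl p) hqp)
  · exact (congrArg (σ p) (hφ p p (hpU p))).trans (hσr p)
  · filter_upwards [(φ p).open_source.mem_nhds hqp] with y hy
    exact (φ p).left_inv hy

/-- The quotient of a manifold by a free smooth action of a compact Lie group is a manifold. -/
theorem exists_isQuotientManifold_orbitRel {n h : ℕ} {H X : Type*}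
    [Group H] [TopologicalSpace H] [CompactSpace H] [ChartedSpace (EuclideanSpace ℝ (Fin h)) H]
    [LieGroup (𝓡 h) ∞ H] [TopologicalSpace X] [T2Space X] [SecondCountableTopology X]
    [ChartedSpace (EuclideanSpace ℝ (Fin n)) X] [IsManifold (𝓡 n) ∞ X]
    [MulAction H X] [ContMDiffSMul (𝓡 h) (𝓡 n) ∞ H X]
    [T2Space (Quotient (MulAction.orbitRel H X))]
    (hfree : ∀ (a : H) (p : X), a • p = p → a = 1) :
    ∃ _ : ChartedSpace (EuclideanSpace ℝ (Fin (n - h))) (Quotient (MulAction.orbitRel H X)),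
      IsQuotientManifold n (n - h) (MulAction.orbitRel H X) := by
  have hcs : ContinuousSMul H X := ContMDiffSMul.continuousSMul (I := 𝓡 h) (I' := 𝓡 n) ∞
  exact exists_isQuotientManifold_of_slices _ isOpenMap_quotient_mk'_mul
    fun p ↦ exists_slice fun a ↦ hfree a p

/-! ### Smooth images of lower-dimensional spaces are null sets -/

/-- Near a point where it is a submersion, all the values of a map are taken on the image of a local
section. -/
theorem Manifold.IsSubmersionAt.exists_local_section {n k : ℕ} {X Y : Type*} [TopologicalSpace X]
    [ChartedSpace (EuclideanSpace ℝ (Fin n)) X] [TopologicalSpace Y]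
    [ChartedSpace (EuclideanSpace ℝ (Fin k)) Y] {q : X → Y} {x : X}
    (h : Manifold.IsSubmersionAt (𝓡 n) (𝓡 k) ∞ q x) [IsManifold (𝓡 n) ∞ X] :
    ∃ (W : Set (EuclideanSpace ℝ (Fin k))) (V : Set X) (s : EuclideanSpace ℝ (Fin k) → X),
      IsOpen W ∧ V ∈ 𝓝 x ∧ ContMDiffOn (𝓡 k) (𝓡 n) ∞ s W ∧ ∀ y ∈ V, ∃ w ∈ W, q (s w) = q y := by
  set φ := h.domChart
  set ψ := h.codChart
  let A := h.equiv
  have hw : ∀ u ∈ φ.target, ψ (q (φ.symm u)) = (A u).1 := by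
    intro u hu
    have h0 : u ∈ (h.domChart.extend (𝓡 n)).target := by simpa using hu
    simpa only [mfld_simps, Function.comp_apply] using h.writtenInCharts h0
  have hx : x ∈ φ.source := h.mem_domChart_source
  -- In the submersion normal form `q` depends only on the first coordinate, so the second can be
  -- frozen at its value at `x`.
  let τ : EuclideanSpace ℝ (Fin k) → EuclideanSpace ℝ (Fin n) := fun w ↦ A.symm (w, (A (φ x)).2)
  have hτ : ContDiff ℝ ∞ τ := by fun_prop
  let W := τ ⁻¹' φ.target
  have hW : IsOpen W := φ.open_target.preimage hτ.continuous
  refine ⟨W, φ.source ∩ (fun y ↦ (A (φ y)).1) ⁻¹' W, φ.symm ∘ τ, hW, ?_, ?_, ?_⟩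
  · refine inter_mem (φ.open_source.mem_nhds hx) ?_
    refine ContinuousAt.preimage_mem_nhds ?_ (hW.mem_nhds ?_)
    · exact (continuous_fst.comp A.continuous).continuousAt.comp (φ.continuousAt hx)
    · simpa [W, τ] using φ.map_source hx
  · exact (contMDiffOn_symm_of_mem_maximalAtlas h.domChart_mem_maximalAtlas).comp
      hτ.contMDiff.contMDiffOn fun w hw ↦ hw
  · intro y hy
    refine ⟨(A (φ y)).1, hy.2, ?_⟩
    have h1 : τ (A (φ y)).1 ∈ φ.target := hy.2
    refine ψ.injOn (h.source_subset_preimage_source (φ.map_target h1))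
      (h.source_subset_preimage_source hy.1) ?_
    have h2 := hw _ (φ.map_source hy.1)
    rw [φ.left_inv hy.1] at h2
    rw [hw _ h1, h2]
    simp [τ]

open MeasureTheory

/-- The image of a differentiable map from a lower-dimensional space is a null set. -/
theorem volume_image_eq_zero_of_lt {k d : ℕ} (hkd : k < d)
    {f : EuclideanSpace ℝ (Fin k) → EuclideanSpace ℝ (Fin d)} {W : Set (EuclideanSpace ℝ (Fin k))}
    (hW : IsOpen W) (hf : ContDiffOn ℝ 1 f W) : volume (f '' W) = 0 := by
  -- A `C¹` map is locally Lipschitz, so it does not raise Hausdorff dimension.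
  have h1 : dimH (f '' W) ≤ dimH W := by
    refine dimH_image_le_of_locally_lipschitzOn fun x hx ↦ ?_
    obtain ⟨C, t, ht, hC⟩ := (hf.contDiffAt (hW.mem_nhds hx)).exists_lipschitzOnWith
    exact ⟨C, t, mem_nhdsWithin_of_mem_nhds ht, hC⟩
  have h2 : dimH W ≤ k := by
    refine (dimH_mono (subset_univ W)).trans ?_
    rw [Real.dimH_univ_eq_finrank]
    simp
  refine measure_zero_of_dimH_lt (d := d) ?_ ((h1.trans h2).trans_lt (by exact_mod_cast hkd))
  have := Measure.absolutelyContinuous_isAddHaarMeasure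
    (volume : Measure (EuclideanSpace ℝ (Fin d))) (Measure.hausdorffMeasure (d : ℝ))
  simpa using this

section

variable {ι : Type*} [Countable ι] {k d : ℕ} {Y : Type*} [TopologicalSpace Y]
  [ChartedSpace (EuclideanSpace ℝ (Fin d)) Y] {W : ι → Set (EuclideanSpace ℝ (Fin k))}
  {j : ι → EuclideanSpace ℝ (Fin k) → Y} {Z : Set Y}

/-- A subset of a manifold that is covered by countably many smooth images of lower-dimensional
spaces is a null set in every chart. -/
theorem volume_chart_image_eq_zero (hkd : k < d) (hW : ∀ i, IsOpen (W i))
    (hj : ∀ i, ContMDiffOn (𝓡 k) (𝓡 d) ∞ (j i) (W i)) (hZ : Z ⊆ ⋃ i, j i '' W i)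
    {e : OpenPartialHomeomorph Y (EuclideanSpace ℝ (Fin d))} [IsManifold (𝓡 d) ∞ Y]
    (he : e ∈ IsManifold.maximalAtlas (𝓡 d) ∞ Y) : volume (e '' (e.source ∩ Z)) = 0 := by
  have hsub : e '' (e.source ∩ Z) ⊆ ⋃ i, (e ∘ j i) '' (W i ∩ j i ⁻¹' e.source) := by
    rintro _ ⟨y, ⟨hye, hyZ⟩, rfl⟩
    obtain ⟨i, w, hw, rfl⟩ := mem_iUnion.1 (hZ hyZ)
    exact mem_iUnion.2 ⟨i, w, ⟨hw, hye⟩, rfl⟩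
  refine measure_mono_null hsub (measure_iUnion_null fun i ↦ ?_)
  refine volume_image_eq_zero_of_lt hkd
    ((hj i).continuousOn.isOpen_inter_preimage (hW i) e.open_source) (ContDiffOn.of_le ?_
      (n := ∞) (by simp))
  rw [← contMDiffOn_iff_contDiffOn]
  exact (contMDiffOn_of_mem_maximalAtlas he).comp ((hj i).mono inter_subset_left) fun w hw ↦ hw.2

/-- A subset of a Lie group that is covered by countably many smooth images of lower-dimensional
spaces is a null set for the Haar measure. -/
theorem haar_eq_zero_of_subset_iUnion_image [T2Space Y] [SecondCountableTopology Y] [Group Y]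
    [LieGroup (𝓡 d) ∞ Y] [MeasurableSpace Y] [BorelSpace Y] (hkd : k < d)
    (hW : ∀ i, IsOpen (W i)) (hj : ∀ i, ContMDiffOn (𝓡 k) (𝓡 d) ∞ (j i) (W i))
    (hZ : Z ⊆ ⋃ i, j i '' W i) (μ : Measure Y) [μ.IsHaarMeasure] : μ Z = 0 := by
  refine measure_mono_null hZ ?_
  set S := ⋃ i, j i '' W i
  have : IsTopologicalGroup Y := topologicalGroup_of_lieGroup (𝓡 d) ∞
  have : LocallyCompactSpace Y := ChartedSpace.locallyCompactSpace (EuclideanSpace ℝ (Fin d)) Y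
  -- Each `W i` is σ-compact, so `S` is a countable union of compact sets.
  have hSm : MeasurableSet S := by
    refine MeasurableSet.iUnion fun i ↦ ?_
    have : LocallyCompactSpace (W i) := (hW i).locallyCompactSpace
    obtain ⟨K, hK, hKu⟩ := (isSigmaCompact_iff_sigmaCompactSpace.2
      (inferInstance : SigmaCompactSpace (W i))).image_of_continuousOn (hj i).continuousOn
    rw [← hKu]
    exact MeasurableSet.iUnion fun n ↦ (hK n).measurableSet
  let c := chartAt (EuclideanSpace ℝ (Fin d)) (1 : Y)
  have hc : c ∈ IsManifold.maximalAtlas (𝓡 d) ∞ Y := IsManifold.chart_mem_maximalAtlas _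
  have hcm : AEMeasurable c.symm (volume.restrict c.target) :=
    c.continuousOn_symm.aemeasurable c.open_target.measurableSet
  -- Lebesgue measure carried over from the chart at `1` is nonzero and kills every right translate
  -- of `S`, since a translate is again a union of smooth images.
  let ν : Measure Y := (volume.restrict c.target).map c.symm
  have hν : ν ≠ 0 := by
    intro h0
    have h1 : ν univ = 0 := by rw [h0]; rfl
    rw [Measure.map_apply_of_aemeasurable hcm .univ, preimage_univ, Measure.restrict_apply_univ] at h1
    exact (c.open_target.measure_pos volume
      ⟨c 1, c.map_source (mem_chart_source _ _)⟩).ne' h1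
  have hnull : ∀ y : Y, ν ((fun x ↦ x * y) ⁻¹' S) = 0 := by
    intro y
    have hm : MeasurableSet ((fun x ↦ x * y) ⁻¹' S) := hSm.preimage (by fun_prop)
    rw [Measure.map_apply_of_aemeasurable hcm hm]
    have hR : ∀ i, ContMDiffOn (𝓡 k) (𝓡 d) ∞ (fun w ↦ j i w * y⁻¹) (W i) := fun i ↦
      (contMDiff_mul_right (I := 𝓡 d) (a := y⁻¹)).comp_contMDiffOn (hj i)
    have hsub : (fun x ↦ x * y) ⁻¹' S ⊆ ⋃ i, (fun w ↦ j i w * y⁻¹) '' W i := by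
      intro x hx
      obtain ⟨i, w, hw, hwx⟩ := mem_iUnion.1 hx
      exact mem_iUnion.2 ⟨i, w, hw, by simp [hwx]⟩
    rw [Measure.restrict_apply₀' c.open_target.measurableSet.nullMeasurableSet]
    refine measure_mono_null ?_ (volume_chart_image_eq_zero hkd hW hR hsub hc)
    rintro u ⟨hu, hut⟩
    exact ⟨c.symm u, ⟨c.map_target hut, hu⟩, c.right_inv hut⟩
  -- By Fubini on `{(y, x) | x * y ∈ S}`, `ν`-almost every `x` has a `μ`-null set of `y` with `x * y
  -- ∈ S`. As `ν ≠ 0` such an `x` exists, and left invariance of `μ` gives `μ S = 0`.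
  have hP : MeasurableSet ((fun p : Y × Y ↦ p.2 * p.1) ⁻¹' S) := hSm.preimage (by fun_prop)
  have h1 : (μ.prod ν) ((fun p : Y × Y ↦ p.2 * p.1) ⁻¹' S) = 0 := by
    rw [Measure.measure_prod_null hP]
    exact Eventually.of_forall hnull
  have h2 : (ν.prod μ) ((fun p : Y × Y ↦ p.1 * p.2) ⁻¹' S) = 0 := by
    rw [← Measure.prod_swap, Measure.map_apply measurable_swap (hSm.preimage (by fun_prop))]
    exact h1
  rw [Measure.measure_prod_null (hSm.preimage (by fun_prop))] at h2
  have : (ae ν).NeBot := ae_neBot.2 hν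
  obtain ⟨x, hx⟩ := h2.exists
  rwa [← measure_preimage_mul μ x S]

end

/-! ### The quotient of `N` and its image in the orbit space -/

/-- The quotient of a stable embedded submanifold by a free smooth action of a compact Lie group is
a manifold. -/
theorem exists_isQuotientManifold_orbitSetoid {m n h : ℕ} {M H : Type*}
    [TopologicalSpace M] [T2Space M] [SecondCountableTopology M]
    [ChartedSpace (EuclideanSpace ℝ (Fin m)) M] [IsManifold (𝓡 m) ∞ M]
    [Group H] [TopologicalSpace H] [CompactSpace H] [ChartedSpace (EuclideanSpace ℝ (Fin h)) H]
    [LieGroup (𝓡 h) ∞ H] [MulAction H M] [ContMDiffSMul (𝓡 h) (𝓡 m) ∞ H M] [ProperSMul H M]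
    (hfree : ∀ (a : H) (p : M), a • p = p → a = 1) {N : Set M}
    (hstable : ∀ (a : H), ∀ p ∈ N, a • p ∈ N) [ChartedSpace (EuclideanSpace ℝ (Fin n)) N]
    (hN : IsSubmanifoldStructure m n N) :
    ∃ _ : ChartedSpace (EuclideanSpace ℝ (Fin (n - h))) (Quotient (orbitSetoid H N)),
      IsQuotientManifold n (n - h) (orbitSetoid H N) := by
  have hman := hN.isManifold
  let act : MulAction H N :=
    { smul := fun a x ↦ ⟨a • (x : M), hstable a x x.2⟩
      one_smul := fun x ↦ Subtype.ext (one_smul H (x : M))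
      mul_smul := fun a b x ↦ Subtype.ext (mul_smul a b (x : M)) }
  have hcoe : ∀ (a : H) (x : N), ((a • x : N) : M) = a • (x : M) := fun _ _ ↦ rfl
  have hcs : ContinuousSMul H M := ContMDiffSMul.continuousSMul (I := 𝓡 h) (I' := 𝓡 m) ∞
  -- As the inclusion is an immersion and the action on `N` is continuous, smoothness may be checked
  -- in `M`.
  have hsmul : ContMDiffSMul (𝓡 h) (𝓡 n) ∞ H N := by
    refine ⟨(ContMDiff.iff_comp_isImmersion hN.isSmoothEmbedding.isImmersion).2 ⟨?_, ?_⟩⟩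
    · exact Continuous.subtype_mk (by fun_prop) _
    · exact (contMDiff_smul (I := 𝓡 h) (I' := 𝓡 m) (n := ∞)).comp
        (contMDiff_fst.prodMk (hN.isSmoothEmbedding.contMDiff.comp contMDiff_snd))
  have hset : MulAction.orbitRel H N = orbitSetoid H N := by
    ext x y
    change x ∈ MulAction.orbit H y ↔ (x : M) ∈ MulAction.orbit H (y : M)
    simp only [MulAction.mem_orbit_iff, Subtype.ext_iff, hcoe]
  -- `N/H` injects continuously into `M/H`, which is Hausdorff by properness.
  have hT2 : T2Space (Quotient (orbitSetoid H N)) := by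
    let F : Quotient (orbitSetoid H N) → Quotient (MulAction.orbitRel H M) :=
      Quotient.map' Subtype.val fun x y hxy ↦ hxy
    refine T2Space.of_injective_continuous (f := F) ?_ ?_
    · rintro ⟨x⟩ ⟨y⟩ hxy
      have h1 : Quotient.mk (MulAction.orbitRel H M) (x : M) = Quotient.mk _ (y : M) := hxy
      exact Quotient.sound (Quotient.exact h1 : MulAction.orbitRel H M x y)
    · exact continuous_subtype_val.quotient_map' _
  rw [← hset] at hT2 ⊢
  exact exists_isQuotientManifold_orbitRel fun a x hx ↦ hfree a x (congrArg Subtype.val hx)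

/-- The image of a submanifold `N` in an orbit space `M/G` is covered by countably many smooth
images of open sets of the model space of the quotient of `N` by a smaller group. -/
theorem exists_orbitImage_subset_iUnion {m n k d : ℕ} {M G : Type*}
    [TopologicalSpace M] [SecondCountableTopology M] [ChartedSpace (EuclideanSpace ℝ (Fin m)) M]
    [Group G] [MulAction G M] (H : Subgroup G) {N : Set M}
    [ChartedSpace (EuclideanSpace ℝ (Fin d)) (Quotient (MulAction.orbitRel G M))]
    [ChartedSpace (EuclideanSpace ℝ (Fin n)) N]
    [ChartedSpace (EuclideanSpace ℝ (Fin k)) (Quotient (orbitSetoid H N))]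
    (hG : IsQuotientManifold m d (MulAction.orbitRel G M)) (hN : IsSubmanifoldStructure m n N)
    (hH : IsQuotientManifold n k (orbitSetoid H N)) :
    ∃ (t : Set N) (W : t → Set (EuclideanSpace ℝ (Fin k)))
      (j : t → EuclideanSpace ℝ (Fin k) → Quotient (MulAction.orbitRel G M)),
      t.Countable ∧ (∀ i, IsOpen (W i)) ∧ (∀ i, ContMDiffOn (𝓡 k) (𝓡 d) ∞ (j i) (W i)) ∧
      orbitImage G N ⊆ ⋃ i, j i '' W i := by
  have hman := hN.isManifold
  choose W V s hW hV hs hVs using fun x : N ↦ (hH.isSubmersion.isSubmersionAt x).exists_local_section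
  -- Second countability of `N` reduces the local sections to countably many.
  obtain ⟨t, ht, htV⟩ := TopologicalSpace.countable_cover_nhds hV
  refine ⟨t, fun i ↦ W i, fun i w ↦ Quotient.mk _ (s i w : M), ht, fun i ↦ hW i, fun i ↦ ?_, ?_⟩
  · exact hG.isSubmersion.contMDiff.comp_contMDiffOn
      (hN.isSmoothEmbedding.contMDiff.comp_contMDiffOn (hs i))
  · rintro _ ⟨p, hp, rfl⟩
    have hpV : (⟨p, hp⟩ : N) ∈ ⋃ x ∈ t, V x := htV ▸ mem_univ _
    obtain ⟨x, hxt, hxV⟩ := mem_iUnion₂.1 hpV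
    obtain ⟨w, hw, hwp⟩ := hVs x _ hxV
    refine mem_iUnion.2 ⟨⟨x, hxt⟩, w, hw, Quotient.sound ?_⟩
    have hrel : orbitSetoid H N (s x w) ⟨p, hp⟩ := Quotient.exact hwp
    obtain ⟨a, ha⟩ := MulAction.orbitRel_apply.1 (show MulAction.orbitRel H M (s x w) p from hrel)
    exact MulAction.orbitRel_apply.2 ⟨(a : G), ha⟩

/-- The last part takes arbitrary structures on `M/G`, `N` and `N/G'`, so the measure statement is
not tied to the ones constructed before it. -/
theorem lemma3 {m b f g g' n' : ℕ} {M B F G : Type*}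
    -- the smooth manifolds `M`, `B`, `F`
    [TopologicalSpace M] [T2Space M] [SecondCountableTopology M]
    [ChartedSpace (EuclideanSpace ℝ (Fin m)) M] [IsManifold (𝓡 m) ∞ M]
    [TopologicalSpace B] [T2Space B] [SecondCountableTopology B]
    [ChartedSpace (EuclideanSpace ℝ (Fin b)) B] [IsManifold (𝓡 b) ∞ B]
    [TopologicalSpace F] [T2Space F] [SecondCountableTopology F]
    [ChartedSpace (EuclideanSpace ℝ (Fin f)) F] [IsManifold (𝓡 f) ∞ F]
    -- the compact Lie groups `G' ≤ G`
    [Group G] [TopologicalSpace G] [T2Space G] [CompactSpace G]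
    [ChartedSpace (EuclideanSpace ℝ (Fin g)) G] [LieGroup (𝓡 g) ∞ G]
    (G' : Subgroup G) [CompactSpace G']
    [ChartedSpace (EuclideanSpace ℝ (Fin g')) G'] [LieGroup (𝓡 g') ∞ G']
    -- their smooth, free and proper actions on `M`
    [MulAction G M] [ContMDiffSMul (𝓡 g) (𝓡 m) ∞ G M] [ProperSMul G M]
    [ContMDiffSMul (𝓡 g') (𝓡 m) ∞ G' M] [ProperSMul G' M]
    (hfree : ∀ (a : G) (p : M), a • p = p → a = 1)
    -- the fiber bundle, whose projection is constant on `G'`-orbits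
    (π : M → B) (hπ : IsSmoothFiberBundle m b f F π)
    (hπG' : ∀ (a : G') (p : M), π (a • p) = π p)
    -- the submanifold of the base
    (N' : Set B) (hN' : IsSubmanifold b n' N') :
    -- `N = π⁻¹(N')` is `G'`-stable
    (∀ (a : G'), ∀ p ∈ π ⁻¹' N', a • p ∈ π ⁻¹' N') ∧
    -- `N` is a submanifold of dimension `dim N' + dim F`
    IsSubmanifold m (n' + f) (π ⁻¹' N') ∧
    -- `M/G` is a smooth manifold
    (∃ (d : ℕ) (_ : ChartedSpace (EuclideanSpace ℝ (Fin d))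
        (Quotient (MulAction.orbitRel G M))),
      IsQuotientManifold m d (MulAction.orbitRel G M)) ∧
    -- `N/G'` is a smooth manifold
    (∀ (_ : ChartedSpace (EuclideanSpace ℝ (Fin (n' + f))) (π ⁻¹' N')),
      IsSubmanifoldStructure m (n' + f) (π ⁻¹' N') →
      ∃ (k : ℕ) (_ : ChartedSpace (EuclideanSpace ℝ (Fin k))
          (Quotient (orbitSetoid G' (π ⁻¹' N')))),
        IsQuotientManifold (n' + f) k (orbitSetoid G' (π ⁻¹' N'))) ∧
    -- with these structures, `k = dim (N/G') < d = dim (M/G)` makes `N/G` a null set in `M/G`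
    (∀ (d : ℕ) (_ : ChartedSpace (EuclideanSpace ℝ (Fin d))
          (Quotient (MulAction.orbitRel G M)))
        (_ : ChartedSpace (EuclideanSpace ℝ (Fin (n' + f))) (π ⁻¹' N'))
        (k : ℕ) (_ : ChartedSpace (EuclideanSpace ℝ (Fin k))
          (Quotient (orbitSetoid G' (π ⁻¹' N')))),
      IsQuotientManifold m d (MulAction.orbitRel G M) →
      IsSubmanifoldStructure m (n' + f) (π ⁻¹' N') →
      IsQuotientManifold (n' + f) k (orbitSetoid G' (π ⁻¹' N')) →
      k < d →
      -- measure zero in every chart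
      (∀ e ∈ IsManifold.maximalAtlas (𝓡 d) ∞ (Quotient (MulAction.orbitRel G M)),
        MeasureTheory.volume (e '' (e.source ∩ orbitImage G (π ⁻¹' N'))) = 0) ∧
      -- Haar measure zero if `M/G` is a Lie group
      (∀ [Group (Quotient (MulAction.orbitRel G M))]
          [LieGroup (𝓡 d) ∞ (Quotient (MulAction.orbitRel G M))]
          [MeasurableSpace (Quotient (MulAction.orbitRel G M))]
          [BorelSpace (Quotient (MulAction.orbitRel G M))]
          (μ : MeasureTheory.Measure (Quotient (MulAction.orbitRel G M))),
        μ.IsHaarMeasure → μ (orbitImage G (π ⁻¹' N')) = 0)) := by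
  have hstable : ∀ (a : G'), ∀ p ∈ π ⁻¹' N', a • p ∈ π ⁻¹' N' := by
    intro a p hp
    rwa [mem_preimage, hπG']
  refine ⟨hstable, hπ.isSubmanifold_preimage hN', ?_, ?_, ?_⟩
  -- If `M` is nonempty then `g ≤ m`, since orbit maps are immersions; if `M` is empty, any
  -- dimension serves.
  · exact ⟨m - g, exists_isQuotientManifold_orbitRel hfree⟩
  · intro cs hN
    exact ⟨n' + f - g', exists_isQuotientManifold_orbitSetoid
      (fun a p hap ↦ Subtype.ext (hfree a p hap)) hstable hN⟩
  · intro d csG csN k csH hG hN hH hkd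
    obtain ⟨t, W, j, ht, hW, hj, hsub⟩ := exists_orbitImage_subset_iUnion G' hG hN hH
    have := ht.to_subtype
    have := hG.isManifold
    refine ⟨fun e he ↦ volume_chart_image_eq_zero hkd hW hj hsub he, ?_⟩
    intro _ _ _ _ μ hμ
    have := hG.t2Space
    have := hG.secondCountableTopology
    exact haar_eq_zero_of_subset_iUnion_image hkd hW hj hsub μ
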